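/- **Setting.** Consider $\dot x=f(x)+g(x)u$, $y_i=h_i(x)+a_i+v_i$ ($i\in[p]=\{1,\dots,p\}$), with $f,g,h_i$ smooth, $x\in\mathbb R^n$, $u,y_i\in\mathbb R$. For all $t\ge 0$: $u(t)\in\mathcal U$ with $\mathcal U$ compact, $x(t)\in\mathcal X=\{w:\|w\|_\infty\le M_x\}$ ($M_x>0$), and $|v_i(t)|\le M_{v,i}$; the attacks $a_i$ need not be bounded. Differential equations are understood in the Carathéodory (integral) sense. For each $i$ assume there are $1\le n_i\le n$ and a diffeomorphism $\Xi_i:\mathbb R^n\to\mathbb R^{n_i}\times\mathbb R^{n-n_i}$, $\Xi_i(x)=(z_i,z_i')$, such that on $\mathcal X$ one has $z_{i,1}=h_i(x)$, $\dot z_{i,j}=z_{i,j+1}+\beta_{i,j}(z_{i,1},\dots,z_{i,j})u$ for $j<n_i$, and $\dot z_{i,n_i}=\alpha_i(z_i)+\beta_{i,n_i}(z_i)u$, with $\alpha_i,\beta_{i,j}$ globally Lipschitz. Put $\Phi_i=(h_i,L_fh_i,\dots,L_f^{n_i-1}h_i)$ and $\Phi_I=(\Phi_i)_{i\in I}$ for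 $I\subset[p]$, and let $M_{z,i}\ge\sup_{\mathcal X}\|\Phi_i\|_\infty$. Assume $2q$-redundant observability: $2q\le p$ and, for all $I$ with $|I|=p-2q$, $\Phi_I$ is an injective immersion on $\mathcal X$. **Observers.** Let $C_i=[1,0,\dots,0]\in\mathbb R^{1\times n_i}$, let $A_i\in\mathbb R^{n_i\times n_i}$ have ones on the first superdiagonal and zeros elsewhere, and let $P_i=P_i(\theta_i)$ be the positive definite solution of $0=-\theta_iP_i-A_i^TP_i-P_iA_i+C_i^TC_i$. The $i$-th observer is the copy of the $z_i$-equations in $\hat z_i$ with the correction term $-P_i^{-1}C_i^T(C_i\hat z_i-y_i)$. Call $(\theta_i,\eta_i,\epsilon_i)$ with $\theta_i>0$ *admissible* if, for every plant trajectory and every noise within the bounds, with $z_i=\Phi_i(x)$, every solution $\hat z_i$ of the attack-free observer on an interval $[s,T]$, $s\ge0$, satisfies $\|\hat z_i(t)-z_i(t)\|_\infty\le\max\{\eta_ie^{-\theta_i(t-s)/8}\|\hat z_i(s)-z_i(s)\|_\infty,\epsilon_i\}$ for $t\in[s,T]$. The observers are started with $\|\hat z_i(0)\|_\infty\le M_{z,i}$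 and use the reset rule: $\hat z_i$ is reset to a vector of norm at most $M_{z,i}$ at the instant after which $\|\hat z_i\|_\infty$ would exceed $\max\{2\eta_iM_{z,i},\epsilon_i\}+M_{z,i}$, and only then (finitely many resets in bounded time); at a reset time, $\hat z_i(t)$ denotes the value before the reset. Put $\delta(t)=\max\{\max_i2M_{z,i}\eta_ie^{-\theta_it/8},\max_i\epsilon_i\}$. **Attacks.** Let $\Delta_1,\Delta_2\ge0$ satisfy $(\max\{2\eta_iM_{z,i},\epsilon_i\}+2M_{z,i})\eta_ie^{-\theta_i\Delta_1/8}\le\epsilon_i$ and $2M_{z,i}\eta_ie^{-\theta_i\Delta_2/8}\le\epsilon_i$ for all $i$, and let $\Delta>\Delta_1+\Delta_2$. Assume that for every $t\ge0$ at least $p-q$ sensors $i$ have $a_i(\tau)=0$ for all $\tau\in[\max\{t-\Delta,0\},t]$. **Switching.** For $|I|=p-q$ let $\Psi^I:\mathbb R^{\mathcal N_I}\to\mathcal X$, where $\mathbb R^{\mathcal N_I}=\prod_{i\in I}\mathbb R^{n_i}$, be Lipschitz on the whole space with $\Psi^I(\Phi_I(x))=x$ on $\mathcal X$. Let $\overline{\mathrm{Lip}}$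 and $\underline{\mathrm{Lip}}$ be the best upper and lower Lipschitz constants in $\|\cdot\|_\infty$ (the first on $\mathbb R^{\mathcal N_I}$, the second on $\mathcal X$). Let $\Lambda$ be a bijection from $\{1,\dots,\binom p{p-q}\}$ onto the $(p-q)$-subsets of $[p]$. The signal $\sigma$ starts from $\sigma(0)=1$ and is updated by $\sigma\leftarrow(\sigma\bmod\binom p{p-q})+1$ whenever, with $I=\Lambda(\sigma(t))$, $$\|\hat z_I(t)-\Phi_I(\Psi^I(\hat z_I(t)))\|_\infty>\overline{\mathrm{Lip}}(\mathrm{id}-\Phi_I\circ\Psi^I)\,\delta(t).$$ Precisely, the next update takes place at the infimum of the times, from the previous update (initially from time $0$) on, at which this inequality holds for the current value; several updates may occur at the same time. **Theorem.** (a) For each $i$ there are $\theta_i^*\ge1$ and functions $\eta_i,\epsilon_i$, non-decreasing on $[\theta_i^*,\infty)$, such that for every $\theta\ge\theta_i^*$ the matrix $P_i(\theta)$ exists and is unique and $(\theta,\eta_i(\theta),\epsilon_i(\theta))$ is admissible. (b) For all admissible $(\theta_i,\eta_i,\epsilon_i)$, $i\in[p]$, with corresponding $P_i$, and all data as above, only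 finitely many updates of $\sigma$ occur in every bounded time interval, and $\hat x(t)=\Psi^{\Lambda(\sigma(t))}(\hat z_{\Lambda(\sigma(t))}(t))$ satisfies $$\|\hat x(t)-x(t)\|_\infty\le\frac{\max_{|I|=p-q}\overline{\mathrm{Lip}}(\mathrm{id}-\Phi_I\circ\Psi^I)+1}{\min_{|J|=p-2q}\underline{\mathrm{Lip}}(\Phi_J)}\,\delta(t)$$ for all $t\ge0$ that are not switching times of $\sigma$. -/

import Mathlib

open scoped ContDiff

namespace ResilientEstimation

noncomputable section

/-! ### Lipschitz constants and Lipschitz-extended left inverses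

All spaces below are (dependent) products of copies of `ℝ`, whose Mathlib norm is the maximum norm. -/

/-- The infimum of the Lipschitz constants of `φ` on `X`. -/
def lipUpper {E F : Type*} [NormedAddCommGroup E] [NormedAddCommGroup F]
    (φ : E → F) (X : Set E) : ℝ :=
  sInf {L : ℝ | 0 ≤ L ∧ ∀ x₁ ∈ X, ∀ x₂ ∈ X, ‖φ x₁ - φ x₂‖ ≤ L * ‖x₁ - x₂‖}

/-- The supremum of the positive lower Lipschitz constants of `φ` on `X`. -/
def lipLower {E F : Type*} [NormedAddCommGroup E] [NormedAddCommGroup F]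
    (φ : E → F) (X : Set E) : ℝ :=
  sSup {L : ℝ | 0 < L ∧ ∀ x₁ ∈ X, ∀ x₂ ∈ X, L * ‖x₁ - x₂‖ ≤ ‖φ x₁ - φ x₂‖}

/-- `ψ` is a Lipschitz-extended left inverse of `φ : X → F`: it is defined and Lipschitz on the whole
space `F`, takes its values in `X`, and satisfies `ψ (φ x) = x` for all `x ∈ X`. -/
structure IsLipschitzLeftInverse {E F : Type*} [NormedAddCommGroup E] [NormedAddCommGroup F]
    (X : Set E) (φ : E → F) (ψ : F → E) : Prop where
  lipschitz : ∃ K, LipschitzWith K ψ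
  mem : ∀ y, ψ y ∈ X
  leftInv : ∀ x ∈ X, ψ (φ x) = x

/-! ### Solutions of ordinary differential equations with possibly discontinuous inputs -/

/-- `w` is a (Carathéodory) solution of `w' (t) = F t (w t)` on `[s, T]`. -/
def IsSolutionOn {E : Type*} [NormedAddCommGroup E] [NormedSpace ℝ E]
    (F : ℝ → E → E) (w : ℝ → E) (s T : ℝ) : Prop :=
  IntervalIntegrable (fun r => F r (w r)) MeasureTheory.volume s T ∧
    ∀ t ∈ Set.Icc s T, w t = w s + ∫ r in s..t, F r (w r)

/-- Trajectories on `[0, ∞)` of `w' (t) = F t (w t)` subject to the reset rule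
"`w (t⁺) ← w₀` (some vector with `‖w₀‖ ≤ M`) if `‖w (t)‖ > R`".

`w t` is the value at time `t` before a possible reset at `t`, and `wplus t` is the value after it.
Because `w` moves continuously between resets, the norm exceeds `R` only after a last instant at which
it is still at most `R`; the reset takes place at that instant. -/
structure IsResetTrajectory {E : Type*} [NormedAddCommGroup E] [NormedSpace ℝ E]
    (F : ℝ → E → E) (M R : ℝ) (w wplus : ℝ → E) (resets : Set ℝ) : Prop where
  init : ‖w 0‖ ≤ M
  resets_nonneg : ∀ s ∈ resets, 0 ≤ s
  /-- only finitely many resets in bounded time -/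
  resets_finite : ∀ T : ℝ, (resets ∩ Set.Icc 0 T).Finite
  plus_of_not_reset : ∀ s, s ∉ resets → wplus s = w s
  /-- a reset puts the state to a vector of norm at most `M` -/
  plus_of_reset : ∀ s ∈ resets, ‖wplus s‖ ≤ M
  /-- without a reset strictly between `s` and `t`, the differential equation holds on `[s, t]`,
  started from the value at time `s` after a possible reset -/
  flow : ∀ s t : ℝ, 0 ≤ s → s < t → (∀ r ∈ resets, ¬ (s < r ∧ r < t)) →
    IsSolutionOn F (Function.update w s (wplus s)) s t
  /-- the reset rule keeps the norm at or below the threshold -/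
  le_threshold : ∀ t : ℝ, 0 ≤ t → ‖w t‖ ≤ R
  /-- a reset happens only if the norm would otherwise exceed the threshold immediately -/
  reset_only : ∀ s ∈ resets, ∃ T > s, ∃ w' : ℝ → E, w' s = w s ∧ IsSolutionOn F w' s T ∧
    ∃ᶠ τ in nhdsWithin s (Set.Ioi s), R < ‖w' τ‖

/-! ### The system -/

/-- The plant `x' = f x + g x * u` with `p` sensors `y i = h i x + a i + v i`, together with the bound
`Mx` on the state, the compact set of input values, and the bounds `Mv i` on the noises. -/
structure SensorSystem (n p : ℕ) where
  f : (Fin n → ℝ) → (Fin n → ℝ)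
  g : (Fin n → ℝ) → (Fin n → ℝ)
  h : Fin p → (Fin n → ℝ) → ℝ
  Mx : ℝ
  inputSet : Set ℝ
  Mv : Fin p → ℝ
  smooth_f : ContDiff ℝ ∞ f
  smooth_g : ContDiff ℝ ∞ g
  smooth_h : ∀ i, ContDiff ℝ ∞ (h i)
  Mx_pos : 0 < Mx
  isCompact_inputSet : IsCompact inputSet

namespace SensorSystem

variable {n p : ℕ} (S : SensorSystem n p)

/-- The state region `{w | ‖w‖ ≤ Mx}` (maximum norm). -/
def stateSet : Set (Fin n → ℝ) := {w | ‖w‖ ≤ S.Mx}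

/-- `x` is a trajectory of the plant under the input `u`, with the standing bounds. -/
structure IsPlantTrajectory (u : ℝ → ℝ) (x : ℝ → Fin n → ℝ) : Prop where
  input_mem : ∀ t, 0 ≤ t → u t ∈ S.inputSet
  state_mem : ∀ t, 0 ≤ t → x t ∈ S.stateSet
  solution : ∀ T, 0 ≤ T → IsSolutionOn (fun t w => S.f w + u t • S.g w) x 0 T

/-- The Lie derivative of `φ` along `f`. -/
def lieDeriv (φ : (Fin n → ℝ) → ℝ) : (Fin n → ℝ) → ℝ := fun x => fderiv ℝ φ x (S.f x)

/-- `Φ_i = (h_i, L_f h_i, …, L_f^(N_i - 1) h_i)`. -/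
def Phi (N : Fin p → ℕ) (i : Fin p) (x : Fin n → ℝ) : Fin (N i) → ℝ :=
  fun j => (S.lieDeriv^[(j : ℕ)]) (S.h i) x

/-- `Φ_I`, the part of the stack `(Φ_1, …, Φ_p)` with indices in `I`. -/
def PhiSub (N : Fin p → ℕ) (I : Finset (Fin p)) (x : Fin n → ℝ) :
    (i : I) → Fin (N i) → ℝ :=
  fun i => S.Phi N i x

/-- `k`-redundant observability: for every `I` with `p - k` elements, `Φ_I` is an injective immersion
on the state region. -/
def RedundantObservable (N : Fin p → ℕ) (k : ℕ) : Prop :=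
  k ≤ p ∧ ∀ I : Finset (Fin p), I.card = p - k →
    Set.InjOn (S.PhiSub N I) S.stateSet ∧
      ∀ x ∈ S.stateSet, Function.Injective (fderiv ℝ (S.PhiSub N I) x)

end SensorSystem

/-! ### Uniformly observable decomposition and the partial observers -/

/-- The right-hand side of the triangular form
`z_j' = z_(j+1) + β_j (z_1, …, z_j) u` for `j < m`, `z_m' = α z + β_m (z_1, …, z_m) u`. -/
def triangularField {m : ℕ} (α : (Fin m → ℝ) → ℝ) (β : (j : Fin m) → (Fin (j + 1) → ℝ) → ℝ)
    (z : Fin m → ℝ) (c : ℝ) : Fin m → ℝ :=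
  fun j => (if hj : (j : ℕ) + 1 < m then z ⟨j + 1, hj⟩ else α z)
    + β j (fun k => z (Fin.castLE j.isLt k)) * c

/-- A uniformly observable decomposition of the system for each single output. For every sensor `i`,
a diffeomorphism `Ξ i` from `ℝ^n` to `ℝ^(N i) × ℝ^(n - N i)` transforms the system on the state region
so that the first component `z` obeys the triangular form and the `i`-th output map is its first
coordinate. (The second component then automatically obeys some equation
`z'' = F (z, z'') + G (z, z'') u`, as `Ξ i` is a diffeomorphism.) -/
structure ObservableDecomposition {n p : ℕ} (S : SensorSystem n p) where
  N : Fin p → ℕ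
  N_pos : ∀ i, 0 < N i
  N_le : ∀ i, N i ≤ n
  Ξ : (i : Fin p) → (Fin n → ℝ) ≃ (Fin (N i) → ℝ) × (Fin (n - N i) → ℝ)
  smooth_Ξ : ∀ i, ContDiff ℝ ∞ (Ξ i)
  smooth_Ξ_symm : ∀ i, ContDiff ℝ ∞ (Ξ i).symm
  α : (i : Fin p) → (Fin (N i) → ℝ) → ℝ
  β : (i : Fin p) → (j : Fin (N i)) → (Fin (j + 1) → ℝ) → ℝ
  lipschitz_α : ∀ i, ∃ K, LipschitzWith K (α i)
  lipschitz_β : ∀ i j, ∃ K, LipschitzWith K (β i j)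
  transformed : ∀ i, ∀ x ∈ S.stateSet, ∀ c : ℝ,
    fderiv ℝ (fun w => (Ξ i w).1) x (S.f x + c • S.g x)
      = triangularField (α i) (β i) (Ξ i x).1 c
  output : ∀ i, ∀ x ∈ S.stateSet, (Ξ i x).1 ⟨0, N_pos i⟩ = S.h i x

/-- The row vector `C = [1, 0, …, 0]`. -/
def rowC (m : ℕ) : Fin m → ℝ := fun j => if (j : ℕ) = 0 then 1 else 0

/-- The matrix `A` with ones on the first superdiagonal. -/
def shiftA (m : ℕ) : Matrix (Fin m) (Fin m) ℝ :=
  Matrix.of fun j k => if (j : ℕ) + 1 = k then 1 else 0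

/-- `P` is a positive definite solution of `0 = -θ P - Aᵀ P - P A + Cᵀ C`. -/
def IsGainMatrix {m : ℕ} (θ : ℝ) (P : Matrix (Fin m) (Fin m) ℝ) : Prop :=
  P.PosDef ∧
    0 = -(θ • P) - (shiftA m).transpose * P - P * shiftA m + Matrix.vecMulVec (rowC m) (rowC m)

/-- The right-hand side of the high-gain observer driven by the input `u` and the measurement `y`:
the triangular form plus the correction `-P⁻¹ Cᵀ (C z - y)`. -/
def observerField {m : ℕ} (α : (Fin m → ℝ) → ℝ) (β : (j : Fin m) → (Fin (j + 1) → ℝ) → ℝ)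
    (P : Matrix (Fin m) (Fin m) ℝ) (u y : ℝ → ℝ) (t : ℝ) (z : Fin m → ℝ) : Fin m → ℝ :=
  triangularField α β z (u t) - (dotProduct (rowC m) z - y t) • (P⁻¹.mulVec (rowC m))

namespace ObservableDecomposition

variable {n p : ℕ} {S : SensorSystem n p} (D : ObservableDecomposition S)

/-- The error estimate that qualifies `θ, η, ε` as constants of the `i`-th partial observer: along every
plant trajectory and for all noise obeying its bound, the attack-free observer, started at any time
`s ≥ 0` from any initial value, satisfies
`‖ẑ t - z t‖ ≤ max {η * exp (-(θ / 8) * (t - s)) * ‖ẑ s - z s‖, ε}`, where `z = Φ_i (x)`. -/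
def ObserverEstimate (i : Fin p) (P : Matrix (Fin (D.N i)) (Fin (D.N i)) ℝ) (θ η ε : ℝ) : Prop :=
  ∀ (u : ℝ → ℝ) (x : ℝ → Fin n → ℝ) (v : ℝ → ℝ),
    S.IsPlantTrajectory u x → (∀ t, 0 ≤ t → |v t| ≤ S.Mv i) →
    ∀ (s T : ℝ) (w : ℝ → Fin (D.N i) → ℝ), 0 ≤ s → s ≤ T →
      IsSolutionOn (observerField (D.α i) (D.β i) P u (fun t => S.h i (x t) + v t)) w s T →
      ∀ t ∈ Set.Icc s T,
        ‖w t - S.Phi D.N i (x t)‖ ≤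
          max (η * Real.exp (-(θ / 8) * (t - s)) * ‖w s - S.Phi D.N i (x s)‖) ε

/-- The map `id - Φ_I ∘ Ψ^I`. -/
def residual (I : Finset (Fin p)) (Ψ : ((i : I) → Fin (D.N i) → ℝ) → (Fin n → ℝ))
    (z : (i : I) → Fin (D.N i) → ℝ) : (i : I) → Fin (D.N i) → ℝ :=
  z - S.PhiSub D.N I (Ψ z)

/-- The upper Lipschitz constant of `id - Φ_I ∘ Ψ^I` on the whole space. -/
def residualLip (I : Finset (Fin p)) (Ψ : ((i : I) → Fin (D.N i) → ℝ) → (Fin n → ℝ)) : ℝ :=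
  lipUpper (D.residual I Ψ) Set.univ

end ObservableDecomposition

/-! ### Attacks, threshold and the switching signal -/

/-- The sensors that have been attack-free during the last `Δ` seconds before time `t`. -/
def attackFree {p : ℕ} (a : Fin p → ℝ → ℝ) (Δ t : ℝ) : Set (Fin p) :=
  {i | ∀ τ : ℝ, max (t - Δ) 0 ≤ τ → τ ≤ t → a i τ = 0}

/-- `δ(t) = max {γ(t), ε}` with `γ(t) = max_i 2 M_i η_i exp (-(θ_i / 8) t)` and `ε = max_i ε_i`. -/
def threshold {p : ℕ} (Mz θ η ε : Fin p → ℝ) (t : ℝ) : ℝ :=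
  max (⨆ i, 2 * Mz i * η i * Real.exp (-(θ i / 8) * t)) (⨆ i, ε i)

/-- The value of the switching signal after `j` updates: it starts from `1`, and an update replaces `m`
by `(m mod c) + 1`. -/
def switchMode (c j : ℕ) : ℕ := (fun m => m % c + 1)^[j] 1

/-- `switchTime c alarm j` is the time of the `j`-th update (`0` for `j = 0`, and `⊤` if there are fewer
than `j` updates). The next update takes place at the first instant, from the previous update on, at
which the test of the current value fails, as `inf {t | …}`. Several updates may have the same time. -/
def switchTime (c : ℕ) (alarm : ℕ → ℝ → Prop) : ℕ → EReal
  | 0 => 0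
  | j + 1 => sInf {s : EReal | ∃ t : ℝ, s = (t : EReal) ∧ switchTime c alarm j ≤ (t : EReal) ∧
      alarm (switchMode c j) t}

/-- The switching signal: `σ(t)` is its value after all updates made before time `t` (before possible
updates at `t` itself). -/
def switchSignal (c : ℕ) (alarm : ℕ → ℝ → Prop) (t : ℝ) : ℕ :=
  switchMode c {j : ℕ | switchTime c alarm (j + 1) < (t : EReal)}.ncard

/-- The failure of the residual test for the index set `Λ m` at time `t`. -/
def residualAlarm {n p : ℕ} {S : SensorSystem n p} (D : ObservableDecomposition S)
    (Λ : ℕ → Finset (Fin p))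
    (Ψ : (I : Finset (Fin p)) → ((i : I) → Fin (D.N i) → ℝ) → (Fin n → ℝ))
    (δ : ℝ → ℝ) (zhat : (i : Fin p) → ℝ → Fin (D.N i) → ℝ) (m : ℕ) (t : ℝ) : Prop :=
  D.residualLip (Λ m) (Ψ (Λ m)) * δ t < ‖D.residual (Λ m) (Ψ (Λ m)) (fun i => zhat i t)‖

end

end ResilientEstimation

open ResilientEstimation

/-! Existence of constants is the high-gain observer argument. On the state region `Φ_i` is the
first block of `Ξ i` (`Phi_eq`), so it obeys the triangular equations, and the observer error `e`
obeys a linear equation plus a Lipschitz perturbation. The gain equation has the explicit unique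
solution `gainMatrix`. In the coordinates `θ⁻¹ ^ j * e j` its quadratic form is `θ⁻¹` times a fixed
positive definite form, while triangularity makes the perturbation Lipschitz uniformly in `θ ≥ 1`.
Hence for large `θ` the function `V = eᵀ P e` satisfies `V' ≤ -(θ / 2) V + Mv ^ 2` almost everywhere
(`lyapunov_decay`). Undoing the scaling costs a power of `θ`, which makes the constants monotone.

For the switching scheme, consider a sensor free of attack on a window longer than `Δ₁ + Δ₂`. Either
its observer is reset during the first `Δ₁` seconds and starts afresh from a small state, or its
error, bounded at the outset by the reset threshold, has decayed below `ε` after `Δ₁`. Both cases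
give an error of at most `δ` (`error_le_of_attackFree`). The slack in `Δ` provides, around every
time, a fixed set `G` of at least `p - q` accurate observers.

The residual map vanishes at `Φ_I (x)`, so a `(p - q)`-subset of `G` raises no alarm locally. The
cyclic search would stop there, and updates cannot accumulate. Away from switching times the current
set `I` passes its test, and `I ∩ G` contains some `J` with `p - 2q` elements. On `J` the estimates
are near `Φ_J (xhat)` by the test and near `Φ_J (x)` by accuracy. The lower Lipschitz constant of
`Φ_J`, positive because an injective immersion is bi-Lipschitz on a compact set, then bounds `xhat -
x` (`switched_estimate`). -/

namespace ResilientEstimation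


/-! ### Best Lipschitz constants, and injective immersions on compact sets. -/

section Lipschitz

variable {E F : Type*} [NormedAddCommGroup E] [NormedAddCommGroup F]

theorem lipUpper_nonneg (φ : E → F) (X : Set E) : 0 ≤ lipUpper φ X :=
  Real.sInf_nonneg fun _ h => h.1

theorem norm_sub_le_lipUpper {φ : E → F} {X : Set E} (h : ∃ K, LipschitzOnWith K φ X)
    {x y : E} (hx : x ∈ X) (hy : y ∈ X) : ‖φ x - φ y‖ ≤ lipUpper φ X * ‖x - y‖ := by
  rcases eq_or_ne x y with rfl | hne
  · simp
  have hpos : 0 < ‖x - y‖ := norm_pos_iff.2 (sub_ne_zero.2 hne)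
  rw [← div_le_iff₀ hpos]
  obtain ⟨K, hK⟩ := h
  refine le_csInf ⟨K, K.2, fun a ha b hb => ?_⟩ fun L hL => ?_
  · simpa [dist_eq_norm] using hK.dist_le_mul a ha b hb
  · rw [div_le_iff₀ hpos]
    exact hL.2 x hx y hy

/-- Two distinct points bound the admissible constants from above; on a subsingleton every constant
is admissible and `sSup` takes its default value `0`. -/
theorem lipLower_spec {φ : E → F} {X : Set E} (hX : X.Nontrivial)
    (h : ∃ L : ℝ, 0 < L ∧ ∀ x ∈ X, ∀ y ∈ X, L * ‖x - y‖ ≤ ‖φ x - φ y‖) :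
    0 < lipLower φ X ∧
      ∀ x ∈ X, ∀ y ∈ X, lipLower φ X * ‖x - y‖ ≤ ‖φ x - φ y‖ := by
  have key : ∀ x ∈ X, ∀ y ∈ X, x ≠ y →
      ∀ L ∈ {L : ℝ | 0 < L ∧ ∀ x₁ ∈ X, ∀ x₂ ∈ X, L * ‖x₁ - x₂‖ ≤ ‖φ x₁ - φ x₂‖},
        L ≤ ‖φ x - φ y‖ / ‖x - y‖ := fun x hx y hy hne L hL => by
    rw [le_div_iff₀ (norm_pos_iff.2 (sub_ne_zero.2 hne))]
    exact hL.2 x hx y hy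
  obtain ⟨L, hL⟩ := h
  obtain ⟨a, ha, b, hb, hab⟩ := hX
  refine ⟨hL.1.trans_le (le_csSup ⟨_, key a ha b hb hab⟩ hL), fun x hx y hy => ?_⟩
  rcases eq_or_ne x y with rfl | hne
  · simp
  rw [← le_div_iff₀ (norm_pos_iff.2 (sub_ne_zero.2 hne))]
  exact csSup_le ⟨L, hL⟩ (key x hx y hy hne)

variable [NormedSpace ℝ E] [NormedSpace ℝ F]

/-- An injective immersion has a positive lower Lipschitz constant on a compact set. -/
theorem exists_lower_lipschitz_of_injective_immersion [FiniteDimensional ℝ E] {φ : E → F}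
    {X : Set E} (hφ : ContDiff ℝ 1 φ) (hX : IsCompact X) (hinj : Set.InjOn φ X)
    (himm : ∀ x ∈ X, Function.Injective (fderiv ℝ φ x)) :
    ∃ L : ℝ, 0 < L ∧ ∀ x ∈ X, ∀ y ∈ X, L * ‖x - y‖ ≤ ‖φ x - φ y‖ := by
  suffices H : ∃ L : ℝ, 0 < L ∧ ∀ z ∈ X ×ˢ X, L * ‖z.1 - z.2‖ ≤ ‖φ z.1 - φ z.2‖ by
    obtain ⟨L, hL, h⟩ := H
    exact ⟨L, hL, fun x hx y hy => h (x, y) ⟨hx, hy⟩⟩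
  -- Having a positive lower constant passes to subsets and finite unions of sets of pairs, so by
  -- compactness it suffices to find one near each pair.
  refine (hX.prod hX).induction_on
    (p := fun s => ∃ L : ℝ, 0 < L ∧ ∀ z ∈ s, L * ‖z.1 - z.2‖ ≤ ‖φ z.1 - φ z.2‖)
    ⟨1, one_pos, by simp⟩ ?_ ?_ ?_
  · rintro s t hst ⟨L, hL, h⟩
    exact ⟨L, hL, fun z hz => h z (hst hz)⟩
  · rintro s t ⟨L, hL, h⟩ ⟨L', hL', h'⟩
    refine ⟨min L L', lt_min hL hL', ?_⟩
    rintro z (hz | hz)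
    · exact (mul_le_mul_of_nonneg_right (min_le_left _ _) (norm_nonneg _)).trans (h z hz)
    · exact (mul_le_mul_of_nonneg_right (min_le_right _ _) (norm_nonneg _)).trans (h' z hz)
  · rintro ⟨x, y⟩ ⟨hx, hy⟩
    rcases eq_or_ne x y with rfl | hne
    -- On the diagonal, strict differentiability lets both points vary: the injective derivative
    -- expands by at least `K⁻¹`, and the remainder takes away at most half of that.
    · obtain ⟨K, hK, hanti⟩ := (fderiv ℝ φ x : E →ₗ[ℝ] F).exists_antilipschitzWith
        (LinearMap.ker_eq_bot.2 (himm x hx))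
      have hK' : (0 : ℝ) < K := hK
      have hstrict : HasStrictFDerivAt φ (fderiv ℝ φ x) x :=
        hφ.contDiffAt.hasStrictFDerivAt (by simp)
      have hlo := hstrict.isLittleO.bound (show (0 : ℝ) < (K : ℝ)⁻¹ / 2 by positivity)
      refine ⟨_, mem_nhdsWithin_of_mem_nhds hlo, (K : ℝ)⁻¹ / 2, by positivity, ?_⟩
      rintro ⟨a, b⟩ hab
      have h1 : ‖φ a - φ b - fderiv ℝ φ x (a - b)‖ ≤ (K : ℝ)⁻¹ / 2 * ‖a - b‖ := hab
      have h2 : ‖a - b‖ ≤ K * ‖fderiv ℝ φ x (a - b)‖ := by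
        have := hanti.le_mul_dist (a - b) 0
        simpa using this
      have h3 : (K : ℝ)⁻¹ * ‖a - b‖ ≤ ‖fderiv ℝ φ x (a - b)‖ := by
        rw [inv_mul_le_iff₀ hK']; exact h2
      have h4 := norm_sub_norm_le (fderiv ℝ φ x (a - b)) (fderiv ℝ φ x (a - b) - (φ a - φ b))
      rw [sub_sub_cancel, norm_sub_rev _ (φ a - φ b)] at h4
      dsimp only
      linarith
    -- Off the diagonal, injectivity keeps the image distance away from zero while the distance in
    -- the domain stays bounded.
    · have hpos : 0 < ‖φ x - φ y‖ :=
        norm_pos_iff.2 (sub_ne_zero.2 fun h => hne (hinj hx hy h))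
      have hc : Continuous fun z : E × E => ‖φ z.1 - φ z.2‖ := by
        have := hφ.continuous
        fun_prop
      have hd : Continuous fun z : E × E => ‖z.1 - z.2‖ := by fun_prop
      have e1 := hc.continuousAt (x := (x, y)) |>.eventually_const_lt (half_lt_self hpos)
      have e2 := hd.continuousAt (x := (x, y)) |>.eventually_lt_const (lt_add_one ‖x - y‖)
      refine ⟨_, mem_nhdsWithin_of_mem_nhds (e1.and e2),
        ‖φ x - φ y‖ / 2 / (‖x - y‖ + 1), by positivity, ?_⟩
      rintro ⟨a, b⟩ ⟨h1, h2⟩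
      refine le_trans ?_ h1.le
      rw [div_mul_eq_mul_div, div_le_iff₀ (by positivity)]
      exact mul_le_mul_of_nonneg_left h2.le (by positivity)

end Lipschitz


/-! ### Restriction and concatenation of Carathéodory solutions. -/

namespace IsSolutionOn

variable {E : Type*} [NormedAddCommGroup E] [NormedSpace ℝ E] {F G : ℝ → E → E}
  {w w₁ w₂ : ℝ → E} {s r T : ℝ}

theorem congr (h : IsSolutionOn F w s T) (hsT : s ≤ T)
    (hF : ∀ t ∈ Set.Icc s T, F t (w t) = G t (w₁ t)) (hw : ∀ t ∈ Set.Icc s T, w t = w₁ t) :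
    IsSolutionOn G w₁ s T := by
  refine ⟨h.1.congr fun t ht => ?_, fun t ht => ?_⟩
  · rw [Set.uIoc_of_le hsT] at ht
    exact hF t (Set.Ioc_subset_Icc_self ht)
  · rw [← hw t ht, ← hw s (Set.left_mem_Icc.2 hsT), h.2 t ht]
    congr 1
    refine intervalIntegral.integral_congr fun τ hτ => ?_
    rw [Set.uIcc_of_le ht.1] at hτ
    exact hF τ ⟨hτ.1, hτ.2.trans ht.2⟩

theorem intervalIntegrable_of_mem (h : IsSolutionOn F w s T) {a b : ℝ}
    (ha : a ∈ Set.Icc s T) (hb : b ∈ Set.Icc s T) :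
    IntervalIntegrable (fun r => F r (w r)) MeasureTheory.volume a b := by
  refine h.1.mono_set ?_
  rw [Set.uIcc_of_le (ha.1.trans ha.2)]
  exact Set.uIcc_subset_Icc ha hb

theorem sub_eq_integral (h : IsSolutionOn F w s T) {a b : ℝ}
    (ha : a ∈ Set.Icc s T) (hb : b ∈ Set.Icc s T) : w b - w a = ∫ r in a..b, F r (w r) := by
  have hs : s ∈ Set.Icc s T := Set.left_mem_Icc.2 (ha.1.trans ha.2)
  rw [h.2 a ha, h.2 b hb, add_sub_add_left_eq_sub, intervalIntegral.integral_interval_sub_left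
    (h.intervalIntegrable_of_mem hs hb) (h.intervalIntegrable_of_mem hs ha)]

theorem mono (h : IsSolutionOn F w s T) {a b : ℝ} (ha : a ∈ Set.Icc s T) (hb : b ∈ Set.Icc s T) :
    IsSolutionOn F w a b :=
  ⟨h.intervalIntegrable_of_mem ha hb, fun t ht =>
    by rw [← h.sub_eq_integral ha ⟨ha.1.trans ht.1, ht.2.trans hb.2⟩]; abel⟩

theorem of_subsingleton_interval (F : ℝ → E → E) (w : ℝ → E) (s : ℝ) : IsSolutionOn F w s s :=
  ⟨IntervalIntegrable.refl, fun t ht => by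
    obtain rfl : t = s := le_antisymm ht.2 ht.1
    simp⟩

theorem trans (h₁ : IsSolutionOn F w s r) (h₂ : IsSolutionOn F w r T) (hsr : s ≤ r)
    (hrT : r ≤ T) : IsSolutionOn F w s T := by
  refine ⟨h₁.1.trans h₂.1, fun t ht => ?_⟩
  rcases le_total t r with htr | hrt
  · exact h₁.2 t ⟨ht.1, htr⟩
  · rw [h₂.2 t ⟨hrt, ht.2⟩, h₁.2 r ⟨hsr, le_rfl⟩, add_assoc,
      intervalIntegral.integral_add_adjacent_intervals h₁.1
        (h₂.intervalIntegrable_of_mem ⟨le_rfl, hrT⟩ ⟨hrt, ht.2⟩)]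

/-- Two solutions with matching values can be concatenated. -/
theorem concat (h₁ : IsSolutionOn F w₁ s r) (h₂ : IsSolutionOn F w₂ r T) (hsr : s ≤ r)
    (hrT : r ≤ T) (hr : w₁ r = w₂ r) :
    IsSolutionOn F (fun t => if t ≤ r then w₁ t else w₂ t) s T := by
  have e₁ : ∀ t ∈ Set.Icc s r, w₁ t = if t ≤ r then w₁ t else w₂ t := fun t ht =>
    (if_pos ht.2).symm
  have e₂ : ∀ t ∈ Set.Icc r T, w₂ t = if t ≤ r then w₁ t else w₂ t := fun t ht => by
    split_ifs with h
    · rw [le_antisymm h ht.1, hr]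
    · rfl
  exact (h₁.congr hsr (fun t ht => by rw [← e₁ t ht]) e₁).trans
    (h₂.congr hrT (fun t ht => by rw [← e₂ t ht]) e₂) hsr hrT

end IsSolutionOn

/-! ### Error of an observer with resets. -/

section Resets

variable {E : Type*} [NormedAddCommGroup E] [NormedSpace ℝ E]

/-- Along the reference signal `z`, all solutions of `w' = F t w` satisfy the exponential error
estimate with rate `θ / 8`, gain `η` and floor `ε`. -/
def ErrorEstimate (F : ℝ → E → E) (z : ℝ → E) (θ η ε : ℝ) : Prop :=
  ∀ (s T : ℝ) (w : ℝ → E), 0 ≤ s → s ≤ T → IsSolutionOn F w s T →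
    ∀ t ∈ Set.Icc s T,
      ‖w t - z t‖ ≤ max (η * Real.exp (-(θ / 8) * (t - s)) * ‖w s - z s‖) ε

variable {F F₀ : ℝ → E → E} {z : ℝ → E} {θ η ε M R : ℝ} {w wplus : ℝ → E} {resets : Set ℝ}

/-- On a degenerate interval every function is a solution, so the estimate can be tested at its
initial time with an error larger than `ε`. -/
theorem ErrorEstimate.gain_pos [Nontrivial E] (h : ErrorEstimate F z θ η ε) : 0 < η := by
  obtain ⟨v, hv⟩ := NormedSpace.exists_lt_norm ℝ E |ε|
  have := h 0 0 (fun _ => z 0 + v) le_rfl le_rfl (.of_subsingleton_interval _ _ _) 0 (by simp)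
  simp only [add_sub_cancel_left, sub_self, mul_zero, Real.exp_zero, mul_one] at this
  rcases le_max_iff.1 this with h1 | h1
  · have h0 : 0 < ‖v‖ := (abs_nonneg ε).trans_lt hv
    exact pos_of_mul_pos_left (h0.trans_le h1) h0.le
  · exact absurd (h1.trans (le_abs_self ε)) hv.not_ge

/-- A reset at `r` would require the unreset continuation to exceed `R` at times arbitrarily close
after `r`. Glued to the flow from `s`, that continuation is an attack-free solution, so it stays
within `R - M` of `z`, hence within `R` of the origin. -/
theorem IsResetTrajectory.not_reset (hw : IsResetTrajectory F M R w wplus resets)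
    (hest : ErrorEstimate F₀ z θ η ε) (hη : 0 ≤ η) (hθ : 0 ≤ θ) (hz : ∀ t, 0 ≤ t → ‖z t‖ ≤ M)
    {s r t : ℝ} (hs : 0 ≤ s) (hsr : s < r) (hrt : r < t)
    (hF : ∀ τ ∈ Set.Icc s t, F τ = F₀ τ) (hno : ∀ r' ∈ resets, ¬ (s < r' ∧ r' < r))
    (hB : max (η * Real.exp (-(θ / 8) * (r - s)) * ‖wplus s - z s‖) ε ≤ R - M) :
    r ∉ resets := by
  intro hr
  obtain ⟨T, hrT, w', hw'r, hw', hfreq⟩ := hw.reset_only r hr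
  have hrm : r < min T t := lt_min hrT hrt
  have hflow := hw.flow s r hs hsr hno
  have hcat := hflow.concat (hw'.mono (a := r) (b := min T t) ⟨le_rfl, hrT.le⟩
    ⟨hrm.le, min_le_left _ _⟩) hsr.le hrm.le
    (by rw [Function.update_of_ne hsr.ne', hw'r])
  have hcat₀ := hcat.congr (G := F₀) (hsr.trans hrm).le
    (fun τ hτ => by rw [hF τ ⟨hτ.1, hτ.2.trans (min_le_right _ _)⟩]) fun _ _ => rfl
  refine hfreq ?_
  filter_upwards [Ioc_mem_nhdsGT hrm] with τ hτ
  have h := hest s _ _ hs (hsr.trans hrm).le hcat₀ τ ⟨(hsr.trans hτ.1).le, hτ.2⟩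
  simp only [hτ.1.not_ge, if_false, hsr.le, if_true, Function.update_self] at h
  have hmono : Real.exp (-(θ / 8) * (τ - s)) ≤ Real.exp (-(θ / 8) * (r - s)) :=
    Real.exp_le_exp.2 (by nlinarith [hτ.1])
  have h2 : ‖w' τ - z τ‖ ≤ R - M := (h.trans (by gcongr)).trans hB
  have h3 := hz τ (hs.trans (hsr.trans hτ.1).le)
  have h4 := norm_add_le (w' τ - z τ) (z τ)
  rw [sub_add_cancel] at h4
  linarith

/-- If there were a reset, the first one would come no earlier than `s + d`, when the error bound
has already decayed enough to exclude it. -/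
theorem IsResetTrajectory.no_resets (hw : IsResetTrajectory F M R w wplus resets)
    (hest : ErrorEstimate F₀ z θ η ε) (hη : 0 ≤ η) (hθ : 0 ≤ θ) (hz : ∀ t, 0 ≤ t → ‖z t‖ ≤ M)
    {s d t : ℝ} (hs : 0 ≤ s) (hF : ∀ τ ∈ Set.Icc s t, F τ = F₀ τ)
    (hno : ∀ r ∈ resets, ¬ (s < r ∧ r < s + d))
    (hB : max (η * Real.exp (-(θ / 8) * d) * ‖wplus s - z s‖) ε ≤ R - M) :
    ∀ r ∈ resets, ¬ (s < r ∧ r < t) := by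
  by_contra! hcon
  obtain ⟨r₀, hr₀, hsr₀, hr₀t⟩ := hcon
  have hfin : (resets ∩ Set.Ioo s t).Finite :=
    (hw.resets_finite t).subset fun r hr => ⟨hr.1, hs.trans hr.2.1.le, hr.2.2.le⟩
  obtain ⟨r, ⟨hr, hsr, hrt⟩, hmin⟩ := hfin.exists_minimal ⟨r₀, hr₀, hsr₀, hr₀t⟩
  have hd : s + d ≤ r := not_lt.1 fun h => hno r hr ⟨hsr, h⟩
  refine hw.not_reset hest hη hθ hz hs hsr hrt hF (fun r' hr' h => ?_) (le_trans ?_ hB) hr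
  · exact absurd (hmin ⟨hr', h.1, h.2.trans hrt⟩ h.2.le) h.2.not_ge
  · have : Real.exp (-(θ / 8) * (r - s)) ≤ Real.exp (-(θ / 8) * d) :=
      Real.exp_le_exp.2 (by nlinarith)
    gcongr

theorem IsResetTrajectory.error_le_of_no_resets (hw : IsResetTrajectory F M R w wplus resets)
    (hest : ErrorEstimate F₀ z θ η ε) {s t : ℝ} (hs : 0 ≤ s) (hst : s < t)
    (hF : ∀ τ ∈ Set.Icc s t, F τ = F₀ τ) (hno : ∀ r ∈ resets, ¬ (s < r ∧ r < t)) :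
    ‖w t - z t‖ ≤ max (η * Real.exp (-(θ / 8) * (t - s)) * ‖wplus s - z s‖) ε := by
  have hflow := (hw.flow s t hs hst hno).congr (G := F₀) hst.le
    (fun τ hτ => by rw [hF τ hτ]) fun _ _ => rfl
  simpa [hst.ne'] using hest s t _ hs hst.le hflow t ⟨hst.le, le_rfl⟩

/-- From a state of norm at most `M` on, an observer whose field is attack-free is not reset, and its
error decays. -/
theorem IsResetTrajectory.error_le_of_small (hw : IsResetTrajectory F M R w wplus resets)
    (hest : ErrorEstimate F₀ z θ η ε) (hη : 0 ≤ η) (hθ : 0 ≤ θ)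
    (hz : ∀ t, 0 ≤ t → ‖z t‖ ≤ M) (hR : R = max (2 * η * M) ε + M) {s t : ℝ} (hs : 0 ≤ s)
    (hst : s < t) (hF : ∀ τ ∈ Set.Icc s t, F τ = F₀ τ) (hsmall : ‖wplus s‖ ≤ M) :
    ‖w t - z t‖ ≤ max (2 * M * η * Real.exp (-(θ / 8) * (t - s))) ε := by
  have hB : ‖wplus s - z s‖ ≤ 2 * M := (norm_sub_le _ _).trans (by linarith [hz s hs])
  -- No waiting time is needed: the threshold leaves room for the undecayed bound `η * (2 * M)` plus
  -- the norm of `z`.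
  have hno := hw.no_resets hest hη hθ hz (d := 0) hs hF (fun r _ h => by linarith [h.1, h.2]) (by
    rw [hR, add_sub_cancel_right, mul_zero, Real.exp_zero, mul_one]
    refine max_le_max ?_ le_rfl
    nlinarith)
  refine (hw.error_le_of_no_resets hest hs hst hF hno).trans (max_le_max ?_ le_rfl)
  have := mul_le_mul_of_nonneg_left hB (mul_nonneg hη (Real.exp_pos (-(θ / 8) * (t - s))).le)
  linarith

/-- An observer that has been attack-free during the last `Δ > Δ₁ + Δ₂` seconds has forgotten the
effect of earlier attacks. -/
theorem IsResetTrajectory.error_le_of_attackFree (hw : IsResetTrajectory F M R w wplus resets)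
    (hest : ErrorEstimate F₀ z θ η ε) (hη : 0 ≤ η) (hθ : 0 ≤ θ) (hM : 0 ≤ M)
    (hz : ∀ t, 0 ≤ t → ‖z t‖ ≤ M) (hR : R = max (2 * η * M) ε + M)
    {Δ₁ Δ₂ Δ : ℝ} (hΔ₁ : 0 ≤ Δ₁) (hΔ₂ : 0 ≤ Δ₂) (hΔ : Δ₁ + Δ₂ < Δ)
    (h₁ : (max (2 * η * M) ε + 2 * M) * η * Real.exp (-(θ / 8) * Δ₁) ≤ ε)
    (h₂ : 2 * M * η * Real.exp (-(θ / 8) * Δ₂) ≤ ε) {t : ℝ} (ht : 0 ≤ t)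
    (hF : ∀ τ ∈ Set.Icc (max (t - Δ) 0) t, F τ = F₀ τ) :
    ‖w t - z t‖ ≤ max (2 * M * η * Real.exp (-(θ / 8) * t)) ε := by
  rcases le_or_gt t Δ with htΔ | htΔ
  · rw [max_eq_right (by linarith)] at hF
    -- Time `0` is separate because `flow` concerns intervals of positive length and the value
    -- before a reset at `0` is the one measured.
    rcases ht.eq_or_lt with rfl | htpos
    · have h := hest 0 0 w le_rfl le_rfl (.of_subsingleton_interval _ _ _) 0 (by simp)
      refine h.trans (max_le_max ?_ le_rfl)
      have hB : ‖w 0 - z 0‖ ≤ 2 * M :=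
        (norm_sub_le _ _).trans (by linarith [hz 0 le_rfl, hw.init])
      have := mul_le_mul_of_nonneg_left hB (mul_nonneg hη (Real.exp_pos (-(θ / 8) * (0 - 0))).le)
      rw [sub_zero] at this ⊢
      linarith
    · have h0 : ‖wplus 0‖ ≤ M := by
        by_cases h : (0 : ℝ) ∈ resets
        · exact hw.plus_of_reset 0 h
        · rw [hw.plus_of_not_reset 0 h]; exact hw.init
      simpa using hw.error_le_of_small hest hη hθ hz hR le_rfl htpos hF h0
  · rw [max_eq_left (by linarith)] at hF
    refine le_trans ?_ (le_max_right _ _)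
    have ht₀ : 0 ≤ t - Δ := by linarith
    -- After a reset this early, more than `Δ₂` seconds remain for the small initial error to decay.
    -- Otherwise the initial error, bounded through the threshold, decays for `Δ₁` seconds without a
    -- reset, and from then on none can occur.
    by_cases hex : ∃ r ∈ resets, t - Δ < r ∧ r < t - Δ + Δ₁
    · obtain ⟨r, hr, hr₁, hr₂⟩ := hex
      refine (hw.error_le_of_small hest hη hθ hz hR (hw.resets_nonneg r hr) (by linarith)
        (fun τ hτ => hF τ ⟨hr₁.le.trans hτ.1, hτ.2⟩) (hw.plus_of_reset r hr)).trans
        (max_le (le_trans ?_ h₂) le_rfl)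
      have : Real.exp (-(θ / 8) * (t - r)) ≤ Real.exp (-(θ / 8) * Δ₂) :=
        Real.exp_le_exp.2 (by nlinarith)
      gcongr
    · push Not at hex
      have hplus : ‖wplus (t - Δ)‖ ≤ R := by
        by_cases h : t - Δ ∈ resets
        · refine (hw.plus_of_reset _ h).trans ?_
          rw [hR]
          have : 0 ≤ 2 * η * M := by positivity
          linarith [le_max_left (2 * η * M) ε]
        · rw [hw.plus_of_not_reset _ h]; exact hw.le_threshold _ ht₀
      have hB : ‖wplus (t - Δ) - z (t - Δ)‖ ≤ max (2 * η * M) ε + 2 * M :=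
        (norm_sub_le _ _).trans (by linarith [hz _ ht₀])
      have hsmall : η * Real.exp (-(θ / 8) * Δ₁) * ‖wplus (t - Δ) - z (t - Δ)‖ ≤ ε := by
        refine le_trans ?_ h₁
        rw [mul_assoc (_ + _), mul_comm (_ + _)]
        gcongr
      have hno := hw.no_resets hest hη hθ hz (d := Δ₁) ht₀ hF
        (fun r hr h => (hex r hr h.1).not_gt h.2) (by
          rw [hR, add_sub_cancel_right]
          exact max_le (hsmall.trans (le_max_right _ _)) (le_max_right _ _))
      refine (hw.error_le_of_no_resets hest ht₀ (by linarith) hF hno).trans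
        (max_le (le_trans ?_ hsmall) le_rfl)
      have : Real.exp (-(θ / 8) * (t - (t - Δ))) ≤ Real.exp (-(θ / 8) * Δ₁) :=
        Real.exp_le_exp.2 (by nlinarith)
      gcongr

end Resets


/-! ### The cyclic search and its switching times. -/

section Switching

theorem switchMode_eq {c : ℕ} (j : ℕ) : switchMode c j = j % c + 1 := by
  induction j with
  | zero => simp [switchMode]
  | succ j ih =>
    rw [switchMode, Function.iterate_succ_apply', ← switchMode, ih, Nat.mod_add_mod]

theorem switchMode_mem {c : ℕ} (hc : 0 < c) (j : ℕ) : switchMode c j ∈ Set.Icc 1 c := by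
  rw [switchMode_eq]
  exact ⟨by omega, Nat.mod_lt j hc⟩

variable {c : ℕ} {alarm : ℕ → ℝ → Prop}

theorem monotone_switchTime : Monotone (switchTime c alarm) :=
  monotone_nat_of_le_succ fun _ => le_sInf fun _ ⟨_, hs, h, _⟩ => hs ▸ h

theorem switchTime_nonneg (j : ℕ) : 0 ≤ switchTime c alarm j :=
  monotone_switchTime (Nat.zero_le j)

/-- If around every time some mode raises no alarm, then the updates do not accumulate. -/
theorem finite_switchTime_le (hsafe : ∀ T : ℝ, 0 ≤ T → ∃ m ∈ Set.Icc 1 c, ∃ h > 0,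
      ∀ t, 0 ≤ t → T - h ≤ t → t ≤ T + h → ¬ alarm m t) (T : ℝ) :
    {j : ℕ | switchTime c alarm j ≤ (T : EReal)}.Finite := by
  by_contra hinf
  have hall : ∀ j, switchTime c alarm j ≤ T := fun j => by
    obtain ⟨k, hk, hjk⟩ := (Set.not_finite.1 hinf).exists_gt j
    exact (monotone_switchTime hjk.le).trans hk
  have hle : ⨆ j, switchTime c alarm j ≤ T := iSup_le hall
  have hge : 0 ≤ ⨆ j, switchTime c alarm j := (switchTime_nonneg 0).trans (le_iSup _ 0)
  obtain ⟨T₀, hT₀⟩ : ∃ T₀ : ℝ, (T₀ : EReal) = ⨆ j, switchTime c alarm j :=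
    ⟨_, EReal.coe_toReal (ne_top_of_le_ne_top (EReal.coe_ne_top T) hle)
      (ne_bot_of_le_ne_bot EReal.zero_ne_bot hge)⟩
  obtain ⟨m, hm, h, hh, hno⟩ := hsafe T₀ (by rw [← hT₀] at hge; exact_mod_cast hge)
  have hlt : ((T₀ - h : ℝ) : EReal) < ⨆ j, switchTime c alarm j := by
    rw [← hT₀]; exact_mod_cast sub_lt_self T₀ hh
  obtain ⟨j₀, hj₀⟩ := lt_iSup_iff.1 hlt
  have hmode : switchMode c (c * j₀ + (m - 1)) = m := by
    rw [switchMode_eq, Nat.mul_add_mod, Nat.mod_eq_of_lt (by have := hm.1; have := hm.2; omega)]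
    have := hm.1
    omega
  have hlarge : j₀ ≤ c * j₀ + (m - 1) := by nlinarith [hm.1.trans hm.2]
  have hnext : ((T₀ + h : ℝ) : EReal) ≤ switchTime c alarm (c * j₀ + (m - 1) + 1) := by
    refine le_sInf ?_
    rintro s ⟨t, rfl, hjt, hal⟩
    rw [hmode] at hal
    by_contra hlt'
    rw [not_le] at hlt'
    refine hno t ?_ ?_ (by exact_mod_cast hlt'.le) hal
    · exact_mod_cast (switchTime_nonneg _).trans hjt
    · exact_mod_cast (hj₀.le.trans (monotone_switchTime hlarge)).trans hjt
  have : ((T₀ + h : ℝ) : EReal) ≤ T₀ := hnext.trans (hT₀ ▸ le_iSup _ _)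
  have h' : T₀ + h ≤ T₀ := by exact_mod_cast this
  linarith

/-- Between switching times the current mode raises no alarm. -/
theorem not_alarm_switchSignal {t : ℝ} (ht : 0 ≤ t)
    (hfin : {j : ℕ | switchTime c alarm j ≤ (t : EReal)}.Finite)
    (hne : ∀ j : ℕ, switchTime c alarm (j + 1) ≠ (t : EReal)) :
    ¬ alarm (switchSignal c alarm t) t := by
  have hex : ∃ k, ¬ switchTime c alarm (k + 1) < (t : EReal) := by
    by_contra! hall
    refine Set.infinite_univ.mono (fun j _ => ?_) hfin
    exact (monotone_switchTime (Nat.le_succ j)).trans (hall j).le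
  classical
  -- By monotonicity the past updates form an initial segment, so their number is the index of the
  -- first update that is not past.
  have hset : {j : ℕ | switchTime c alarm (j + 1) < (t : EReal)} = Set.Iio (Nat.find hex) := by
    ext j
    refine ⟨fun hj => ?_, fun hj => not_not.1 (Nat.find_min hex hj)⟩
    by_contra hge
    refine Nat.find_spec hex ((monotone_switchTime ?_).trans_lt hj)
    exact Nat.add_le_add_right (not_lt.1 hge) 1
  rw [switchSignal, hset, Set.ncard_eq_toFinset_card', Set.toFinset_Iio, Nat.card_Iio]
  intro hal
  have hprev : switchTime c alarm (Nat.find hex) ≤ t := by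
    rcases Nat.eq_zero_or_pos (Nat.find hex) with h0 | hpos
    · rw [h0, switchTime]
      exact_mod_cast ht
    · obtain ⟨k, hk⟩ := Nat.exists_eq_succ_of_ne_zero hpos.ne'
      rw [hk]
      exact (not_not.1 (Nat.find_min hex (hk ▸ Nat.lt_succ_self k))).le
  -- An alarm at `t` would put the next update at or before `t`; it is not in the past, so `t` would
  -- be a switching time.
  have hle : switchTime c alarm (Nat.find hex + 1) ≤ t := sInf_le ⟨t, rfl, hprev, hal⟩
  exact Nat.find_spec hex (hle.lt_of_ne (hne _))

end Switching

/-! ### Smoothness and lower Lipschitz constants of the observability maps. -/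

namespace SensorSystem

variable {n p : ℕ} (S : SensorSystem n p)

theorem stateSet_eq_closedBall : S.stateSet = Metric.closedBall 0 S.Mx := by
  ext; simp [stateSet]

theorem isCompact_stateSet : IsCompact S.stateSet := by
  rw [stateSet_eq_closedBall]; exact isCompact_closedBall _ _

theorem convex_stateSet : Convex ℝ S.stateSet := by
  rw [stateSet_eq_closedBall]; exact convex_closedBall _ _

theorem nontrivial_stateSet (hn : 0 < n) : S.stateSet.Nontrivial := by
  have : Nonempty (Fin n) := ⟨⟨0, hn⟩⟩
  refine ⟨0, by simpa [stateSet] using S.Mx_pos.le, fun _ => S.Mx, ?_, fun h => ?_⟩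
  · simp [stateSet, abs_of_pos S.Mx_pos]
  · exact S.Mx_pos.ne (congrFun h ⟨0, hn⟩)

theorem contDiff_lieDeriv {φ : (Fin n → ℝ) → ℝ} (hφ : ContDiff ℝ ∞ φ) :
    ContDiff ℝ ∞ (S.lieDeriv φ) :=
  (hφ.fderiv_right (by norm_cast)).clm_apply S.smooth_f

theorem contDiff_iterate_lieDeriv (i : Fin p) (k : ℕ) :
    ContDiff ℝ ∞ (S.lieDeriv^[k] (S.h i)) := by
  induction k with
  | zero => exact S.smooth_h i
  | succ k ih => rw [Function.iterate_succ_apply']; exact S.contDiff_lieDeriv ih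

theorem contDiff_Phi (N : Fin p → ℕ) (i : Fin p) : ContDiff ℝ ∞ (S.Phi N i) :=
  contDiff_pi.2 fun j => S.contDiff_iterate_lieDeriv i j

theorem contDiff_PhiSub (N : Fin p → ℕ) (I : Finset (Fin p)) : ContDiff ℝ ∞ (S.PhiSub N I) :=
  contDiff_pi.2 fun i => S.contDiff_Phi N i

theorem lipLower_PhiSub_spec {N : Fin p → ℕ} {k : ℕ} (hobs : S.RedundantObservable N k)
    (hn : 0 < n) {J : Finset (Fin p)} (hJ : J.card = p - k) :
    0 < lipLower (S.PhiSub N J) S.stateSet ∧ ∀ x ∈ S.stateSet, ∀ y ∈ S.stateSet,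
      lipLower (S.PhiSub N J) S.stateSet * ‖x - y‖ ≤ ‖S.PhiSub N J x - S.PhiSub N J y‖ :=
  lipLower_spec (S.nontrivial_stateSet hn)
    (exists_lower_lipschitz_of_injective_immersion ((S.contDiff_PhiSub N J).of_le (by norm_cast))
      S.isCompact_stateSet (hobs.2 J hJ).1 (hobs.2 J hJ).2)

end SensorSystem

/-! ### Lipschitz bounds for the residual maps. -/

namespace ObservableDecomposition

variable {n p : ℕ} {S : SensorSystem n p} (D : ObservableDecomposition S)

theorem residualLip_nonneg (I : Finset (Fin p))
    (Ψ : ((i : I) → Fin (D.N i) → ℝ) → (Fin n → ℝ)) : 0 ≤ D.residualLip I Ψ :=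
  lipUpper_nonneg _ _

variable {I : Finset (Fin p)} {Ψ : ((i : I) → Fin (D.N i) → ℝ) → (Fin n → ℝ)}

/-- `Φ_I` need only be Lipschitz on the compact convex state region, since `Ψ` takes its values
there; the composition is then globally Lipschitz. -/
theorem norm_residual_sub_le (hΨ : IsLipschitzLeftInverse S.stateSet (S.PhiSub D.N I) Ψ)
    (z z' : (i : I) → Fin (D.N i) → ℝ) :
    ‖D.residual I Ψ z - D.residual I Ψ z'‖ ≤ D.residualLip I Ψ * ‖z - z'‖ := by
  refine norm_sub_le_lipUpper ?_ (Set.mem_univ z) (Set.mem_univ z')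
  obtain ⟨K, hK⟩ := hΨ.lipschitz
  obtain ⟨K', hK'⟩ := (S.contDiff_PhiSub D.N I).contDiffOn.exists_lipschitzOnWith (by simp)
    S.convex_stateSet S.isCompact_stateSet
  have hcomp := hK'.comp (hK.lipschitzOnWith (s := Set.univ)) fun y _ => hΨ.mem y
  exact ⟨1 + K' * K, (LipschitzWith.id.lipschitzOnWith (s := Set.univ)).sub hcomp⟩

theorem norm_residual_le (hΨ : IsLipschitzLeftInverse S.stateSet (S.PhiSub D.N I) Ψ)
    {x : Fin n → ℝ} (hx : x ∈ S.stateSet) (z : (i : I) → Fin (D.N i) → ℝ) :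
    ‖D.residual I Ψ z‖ ≤ D.residualLip I Ψ * ‖z - S.PhiSub D.N I x‖ := by
  have h := D.norm_residual_sub_le hΨ z (S.PhiSub D.N I x)
  have h0 : D.residual I Ψ (S.PhiSub D.N I x) = 0 := by
    rw [residual, hΨ.leftInv x hx, sub_self]
  rwa [h0, sub_zero] at h

theorem ObserverEstimate.errorEstimate {D : ObservableDecomposition S} {i : Fin p}
    {P : Matrix (Fin (D.N i)) (Fin (D.N i)) ℝ} {θ η ε : ℝ} (h : D.ObserverEstimate i P θ η ε)
    {u : ℝ → ℝ} {x : ℝ → Fin n → ℝ} {v : ℝ → ℝ} (hx : S.IsPlantTrajectory u x)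
    (hv : ∀ t, 0 ≤ t → |v t| ≤ S.Mv i) :
    ErrorEstimate (observerField (D.α i) (D.β i) P u (fun t => S.h i (x t) + v t))
      (fun t => S.Phi D.N i (x t)) θ η ε :=
  fun s T w => h u x v hx hv s T w

end ObservableDecomposition

/-! ### The threshold and the error bound of the switched estimator. -/

section Threshold

variable {p : ℕ} {Mz θ η ε : Fin p → ℝ}

theorem threshold_nonneg (hM : ∀ i, 0 ≤ Mz i) (hη : ∀ i, 0 ≤ η i) (t : ℝ) :
    0 ≤ threshold Mz θ η ε t :=
  (Real.iSup_nonneg fun i => mul_nonneg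
    (mul_nonneg (mul_nonneg zero_le_two (hM i)) (hη i)) (Real.exp_pos _).le).trans (le_max_left _ _)

theorem le_threshold (i : Fin p) (t : ℝ) :
    max (2 * Mz i * η i * Real.exp (-(θ i / 8) * t)) (ε i) ≤ threshold Mz θ η ε t :=
  max_le_max
    (le_ciSup (f := fun i => 2 * Mz i * η i * Real.exp (-(θ i / 8) * t))
      (Set.finite_range _).bddAbove i)
    (le_ciSup (Set.finite_range _).bddAbove i)

end Threshold

/-- The switched estimator: finitely many updates in bounded time, and the resulting error bound. -/
theorem switched_estimate {n p q : ℕ} (S : SensorSystem n p) (D : ObservableDecomposition S)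
    (hobs : S.RedundantObservable D.N (2 * q))
    {δ : ℝ → ℝ} (hδ : ∀ t, 0 ≤ δ t) {x : ℝ → Fin n → ℝ} (hx : ∀ t, 0 ≤ t → x t ∈ S.stateSet)
    {Ψ : (I : Finset (Fin p)) → ((i : I) → Fin (D.N i) → ℝ) → (Fin n → ℝ)}
    (hΨ : ∀ I : Finset (Fin p), I.card = p - q →
      IsLipschitzLeftInverse S.stateSet (S.PhiSub D.N I) (Ψ I))
    {Λ : ℕ → Finset (Fin p)}
    (hΛ : Set.BijOn Λ (Set.Icc 1 (p.choose (p - q))) {I | I.card = p - q})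
    {zhat : (i : Fin p) → ℝ → Fin (D.N i) → ℝ}
    (hgood : ∀ T, 0 ≤ T → ∃ G : Finset (Fin p), p - q ≤ G.card ∧ ∃ h > 0, ∀ i ∈ G, ∀ t, 0 ≤ t →
      T - h ≤ t → t ≤ T + h → ‖zhat i t - S.Phi D.N i (x t)‖ ≤ δ t) :
    let alarm := residualAlarm D Λ Ψ δ zhat
    let τ := switchTime (p.choose (p - q)) alarm
    let σ := switchSignal (p.choose (p - q)) alarm
    (∀ T : ℝ, {j : ℕ | τ j ≤ (T : EReal)}.Finite) ∧
      ∀ t : ℝ, 0 ≤ t → (∀ j : ℕ, τ (j + 1) ≠ (t : EReal)) →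
        ‖Ψ (Λ (σ t)) (fun i => zhat i t) - x t‖ ≤
          ((⨆ I : {I : Finset (Fin p) // I.card = p - q}, D.residualLip I.1 (Ψ I.1)) + 1)
            / (⨅ J : {J : Finset (Fin p) // J.card = p - 2 * q},
                lipLower (S.PhiSub D.N J.1) S.stateSet)
            * δ t := by
  intro alarm τ σ
  have hfin : ∀ T : ℝ, {j : ℕ | τ j ≤ (T : EReal)}.Finite := by
    refine finite_switchTime_le fun T hT => ?_
    obtain ⟨G, hG, h, hh, hGe⟩ := hgood T hT
    obtain ⟨I, hIG, hI⟩ := Finset.exists_subset_card_eq hG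
    obtain ⟨m, hm, rfl⟩ := hΛ.surjOn hI
    refine ⟨m, hm, h, hh, fun t ht h1 h2 => ?_⟩
    simp only [alarm, residualAlarm, not_lt]
    refine (D.norm_residual_le (hΨ _ hI) (hx t ht) _).trans
      (mul_le_mul_of_nonneg_left ?_ (D.residualLip_nonneg _ _))
    exact (pi_norm_le_iff_of_nonneg (hδ t)).2 fun i => hGe i (hIG i.2) t ht h1 h2
  refine ⟨hfin, fun t ht hne => ?_⟩
  have hsup : 0 ≤ ⨆ I : {I : Finset (Fin p) // I.card = p - q}, D.residualLip I.1 (Ψ I.1) :=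
    Real.iSup_nonneg fun I => D.residualLip_nonneg _ _
  -- In dimension zero the state region is a single point and `lipLower` is meaningless, but the
  -- error vanishes and the right-hand side is nonnegative.
  rcases Nat.eq_zero_or_pos n with rfl | hn
  · rw [Subsingleton.elim (Ψ (Λ (σ t)) (fun i => zhat i t) - x t) 0, norm_zero]
    refine mul_nonneg (div_nonneg (by linarith) (Real.iInf_nonneg fun J => ?_)) (hδ t)
    exact Real.sSup_nonneg fun L hL => hL.1.le
  have hσ : (Λ (σ t)).card = p - q :=
    hΛ.mapsTo (switchMode_mem (Nat.choose_pos (Nat.sub_le p q)) _)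
  have hquiet : ¬ alarm (σ t) t := not_alarm_switchSignal ht (hfin t) hne
  simp only [alarm, residualAlarm, not_lt] at hquiet
  set I := Λ (σ t) with hI
  set xh := Ψ I (fun i => zhat i t) with hxh
  obtain ⟨G, hG, h, hh, hGe⟩ := hgood t ht
  -- Two sets of at least `p - q` sensors among `p` share at least `p - 2q` of them.
  have hcard : p - 2 * q ≤ (I ∩ G).card := by
    have h1 := Finset.card_inter_add_card_union I G
    have h2 := (I ∪ G).card_le_univ
    rw [Fintype.card_fin] at h2
    omega
  obtain ⟨J, hJsub, hJ⟩ := Finset.exists_subset_card_eq hcard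
  have hLI : D.residualLip I (Ψ I) ≤
      ⨆ I : {I : Finset (Fin p) // I.card = p - q}, D.residualLip I.1 (Ψ I.1) :=
    le_ciSup (f := fun I : {I : Finset (Fin p) // I.card = p - q} => D.residualLip I.1 (Ψ I.1))
      (Set.finite_range _).bddAbove ⟨I, hσ⟩
  have hxhmem : xh ∈ S.stateSet := (hΨ I hσ).mem _
  have hbound : ‖S.PhiSub D.N J xh - S.PhiSub D.N J (x t)‖ ≤
      (D.residualLip I (Ψ I) + 1) * δ t := by
    refine (pi_norm_le_iff_of_nonneg (mul_nonneg
      (by linarith [D.residualLip_nonneg I (Ψ I)]) (hδ t))).2 fun i => ?_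
    have hiI : (i : Fin p) ∈ I := (Finset.mem_inter.1 (hJsub i.2)).1
    have hiG : (i : Fin p) ∈ G := (Finset.mem_inter.1 (hJsub i.2)).2
    -- For a sensor in `J`, the passed test compares its estimate with `xh`, and its accuracy
    -- compares it with `x t`.
    have e1 : ‖zhat i t - S.Phi D.N i xh‖ ≤ D.residualLip I (Ψ I) * δ t :=
      (norm_le_pi_norm (D.residual I (Ψ I) fun i => zhat i t) ⟨i, hiI⟩).trans hquiet
    have e2 := hGe i hiG t ht (by linarith) (by linarith)
    have e3 := norm_sub_le (zhat i t - S.Phi D.N i (x t)) (zhat i t - S.Phi D.N i xh)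
    rw [sub_sub_sub_cancel_left] at e3
    change ‖S.Phi D.N i xh - S.Phi D.N i (x t)‖ ≤ _
    linarith
  have : Nonempty {J : Finset (Fin p) // J.card = p - 2 * q} := ⟨⟨J, hJ⟩⟩
  -- The minimum over finitely many index sets is attained, hence positive.
  obtain ⟨J₀, hJ₀⟩ := exists_eq_ciInf_of_finite
    (f := fun J : {J : Finset (Fin p) // J.card = p - 2 * q} =>
      lipLower (S.PhiSub D.N J.1) S.stateSet)
  have hpos : 0 < ⨅ J : {J : Finset (Fin p) // J.card = p - 2 * q},
      lipLower (S.PhiSub D.N J.1) S.stateSet := by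
    rw [← hJ₀]; exact (S.lipLower_PhiSub_spec hobs hn J₀.2).1
  have hinf : (⨅ J : {J : Finset (Fin p) // J.card = p - 2 * q},
      lipLower (S.PhiSub D.N J.1) S.stateSet) ≤ lipLower (S.PhiSub D.N J) S.stateSet :=
    ciInf_le (f := fun J : {J : Finset (Fin p) // J.card = p - 2 * q} =>
      lipLower (S.PhiSub D.N J.1) S.stateSet) (Set.finite_range _).bddBelow ⟨J, hJ⟩
  rw [div_mul_eq_mul_div, le_div_iff₀ hpos, mul_comm ‖_‖]
  calc _ ≤ lipLower (S.PhiSub D.N J) S.stateSet * ‖xh - x t‖ := by gcongr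
    _ ≤ _ := (S.lipLower_PhiSub_spec hobs hn hJ).2 _ hxhmem _ (hx t ht)
    _ ≤ _ := hbound
    _ ≤ _ := by
      have := hδ t
      gcongr

/-- With the constants of the partial observers, the sensors that are attack-free during a window of
length `Δ > Δ₁ + Δ₂` have accurate estimates around every time. -/
theorem exists_accurate_observers {n p q : ℕ} (S : SensorSystem n p)
    (D : ObservableDecomposition S) {θ η ε Mz : Fin p → ℝ}
    {P : (i : Fin p) → Matrix (Fin (D.N i)) (Fin (D.N i)) ℝ}
    (hθ : ∀ i, 0 < θ i) (hest : ∀ i, D.ObserverEstimate i (P i) (θ i) (η i) (ε i))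
    (hMz : ∀ i, ∀ x ∈ S.stateSet, ‖S.Phi D.N i x‖ ≤ Mz i)
    {u : ℝ → ℝ} {x : ℝ → Fin n → ℝ} {v a : Fin p → ℝ → ℝ}
    (hx : S.IsPlantTrajectory u x) (hv : ∀ i t, 0 ≤ t → |v i t| ≤ S.Mv i)
    {Δ₁ Δ₂ Δ : ℝ} (hΔ₁ : 0 ≤ Δ₁) (hΔ₂ : 0 ≤ Δ₂) (hΔ : Δ₁ + Δ₂ < Δ)
    (h₁ : ∀ i, (max (2 * η i * Mz i) (ε i) + 2 * Mz i) * η i * Real.exp (-(θ i / 8) * Δ₁) ≤ ε i)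
    (h₂ : ∀ i, 2 * Mz i * η i * Real.exp (-(θ i / 8) * Δ₂) ≤ ε i)
    (hatt : ∀ t : ℝ, 0 ≤ t → p - q ≤ (attackFree a Δ t).ncard)
    {zhat zplus : (i : Fin p) → ℝ → Fin (D.N i) → ℝ} {resets : Fin p → Set ℝ}
    (hz : ∀ i, IsResetTrajectory
      (observerField (D.α i) (D.β i) (P i) u (fun t => S.h i (x t) + a i t + v i t))
      (Mz i) (max (2 * η i * Mz i) (ε i) + Mz i) (zhat i) (zplus i) (resets i)) :
    (∀ t, 0 ≤ threshold Mz θ η ε t) ∧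
    ∀ T, 0 ≤ T → ∃ G : Finset (Fin p), p - q ≤ G.card ∧ ∃ h > 0, ∀ i ∈ G, ∀ t, 0 ≤ t →
      T - h ≤ t → t ≤ T + h →
        ‖zhat i t - S.Phi D.N i (x t)‖ ≤ threshold Mz θ η ε t := by
  have hest' := fun i => (hest i).errorEstimate hx (hv i)
  have hη : ∀ i, 0 ≤ η i := fun i => by
    have : Nonempty (Fin (D.N i)) := ⟨⟨0, D.N_pos i⟩⟩
    exact (hest' i).gain_pos.le
  have hM : ∀ i, 0 ≤ Mz i := fun i =>
    (norm_nonneg _).trans (hMz i (x 0) (hx.state_mem 0 le_rfl))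
  refine ⟨threshold_nonneg hM hη, fun T hT => ?_⟩
  -- The window of length `Δ` ending at `T + h` contains the window of length `Δ - 2 * h` ending at
  -- any `t` in `[T - h, T + h]`, and `Δ - 2 * h` still exceeds `Δ₁ + Δ₂`. One set of sensors thus
  -- serves the whole neighbourhood.
  set h := (Δ - (Δ₁ + Δ₂)) / 4 with hh
  have hpos : 0 < h := by rw [hh]; linarith
  classical
  refine ⟨(attackFree a Δ (T + h)).toFinset, ?_, h, hpos, fun i hi t ht h1 h2 => ?_⟩
  · rw [← Set.ncard_eq_toFinset_card']
    exact hatt _ (by linarith)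
  refine le_trans ?_ (le_threshold i t)
  refine (hz i).error_le_of_attackFree (hest' i) (hη i) (hθ i).le (hM i)
    (fun t ht => hMz i _ (hx.state_mem t ht)) rfl hΔ₁ hΔ₂ (Δ := Δ - 2 * h) (by linarith)
    (h₁ i) (h₂ i) ht fun τ hτ => ?_
  have ha : a i τ = 0 := by
    refine Set.mem_toFinset.1 hi τ (le_trans (max_le_max ?_ le_rfl) hτ.1) (hτ.2.trans h2)
    linarith
  funext z
  simp only [observerField, ha, add_zero]


/-! ### The observability map as the triangular coordinates. -/

namespace ObservableDecomposition

variable {n p : ℕ} {S : SensorSystem n p} (D : ObservableDecomposition S)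

theorem contDiff_fst_Ξ (i : Fin p) : ContDiff ℝ ∞ fun w => (D.Ξ i w).1 :=
  (D.smooth_Ξ i).fst

/-- With zero input, row `k` of the triangular form says that the Lie derivative of coordinate `k`
is coordinate `k + 1`. Equality on the closed ball determines derivatives only in its interior, so
the induction step is done on the open ball and extended by continuity. -/
theorem iterate_lieDeriv_eqOn (i : Fin p) (k : ℕ) (hk : k < D.N i) :
    Set.EqOn (S.lieDeriv^[k] (S.h i)) (fun x => (D.Ξ i x).1 ⟨k, hk⟩) S.stateSet := by
  induction k with
  | zero => exact fun x hx => (D.output i x hx).symm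
  | succ k ih =>
    have ih := ih (by omega)
    rw [S.stateSet_eq_closedBall, ← closure_ball _ S.Mx_pos.ne']
    refine Set.EqOn.closure (fun x hx => ?_) (S.contDiff_iterate_lieDeriv i _).continuous
      ((continuous_apply _).comp (D.contDiff_fst_Ξ i).continuous)
    have hxs : x ∈ S.stateSet := by
      rw [S.stateSet_eq_closedBall]; exact Metric.ball_subset_closedBall hx
    have heq : S.lieDeriv^[k] (S.h i) =ᶠ[nhds x] fun x => (D.Ξ i x).1 ⟨k, by omega⟩ := by
      filter_upwards [Metric.isOpen_ball.mem_nhds hx] with y hy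
      exact ih (by rw [S.stateSet_eq_closedBall]; exact Metric.ball_subset_closedBall hy)
    have hd : DifferentiableAt ℝ (fun w => (D.Ξ i w).1) x :=
      (D.contDiff_fst_Ξ i).differentiable (by simp) x
    have htr := congrFun (D.transformed i x hxs 0) ⟨k, by omega⟩
    rw [Function.iterate_succ_apply', SensorSystem.lieDeriv, heq.fderiv_eq,
      fderiv_apply hd]
    rw [zero_smul, add_zero] at htr
    simp only [ContinuousLinearMap.comp_apply, ContinuousLinearMap.proj_apply]
    rw [htr]
    simp [triangularField, hk]

theorem Phi_eq (i : Fin p) {x : Fin n → ℝ} (hx : x ∈ S.stateSet) :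
    S.Phi D.N i x = (D.Ξ i x).1 :=
  funext fun j => D.iterate_lieDeriv_eqOn i j j.isLt hx

end ObservableDecomposition

/-! ### Explicit solution and uniqueness for the gain equation. -/

section Gain

open Matrix

variable {m : ℕ}

theorem shiftA_transpose_mul_apply (P : Matrix (Fin m) (Fin m) ℝ) (i j : Fin m) :
    ((shiftA m)ᵀ * P) i j = if (i : ℕ) = 0 then 0 else P ⟨i - 1, by omega⟩ j := by
  rw [mul_apply]
  simp only [shiftA, transpose_apply, of_apply, ite_mul, one_mul, zero_mul]
  split_ifs with h
  · exact Finset.sum_eq_zero fun k _ => if_neg (by omega)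
  · rw [Finset.sum_eq_single ⟨i - 1, by omega⟩]
    · exact if_pos (by simp only; omega)
    · exact fun k _ hk => if_neg fun h' => hk (Fin.ext (by simp only; omega))
    · simp

theorem mul_shiftA_apply (P : Matrix (Fin m) (Fin m) ℝ) (i j : Fin m) :
    (P * shiftA m) i j = if (j : ℕ) = 0 then 0 else P i ⟨j - 1, by omega⟩ := by
  have h := shiftA_transpose_mul_apply Pᵀ j i
  rwa [← transpose_mul, transpose_apply] at h

theorem gain_equation_iff {θ : ℝ} {P : Matrix (Fin m) (Fin m) ℝ} :
    0 = -(θ • P) - (shiftA m)ᵀ * P - P * shiftA m + vecMulVec (rowC m) (rowC m) ↔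
      ∀ i j : Fin m, θ * P i j + (if (i : ℕ) = 0 then 0 else P ⟨i - 1, by omega⟩ j)
        + (if (j : ℕ) = 0 then 0 else P i ⟨j - 1, by omega⟩) = rowC m i * rowC m j := by
  rw [← Matrix.ext_iff]
  refine forall_congr' fun i => forall_congr' fun j => ?_
  rw [Matrix.add_apply, Matrix.sub_apply, Matrix.sub_apply, Matrix.neg_apply, Matrix.smul_apply,
    shiftA_transpose_mul_apply,
    mul_shiftA_apply, vecMulVec_apply, Matrix.zero_apply, smul_eq_mul]
  constructor <;> intro h <;> linarith

/-- Entrywise, the equation expresses `θ * P i j` through entries with smaller index sum. -/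
theorem IsGainMatrix.unique {θ : ℝ} (hθ : θ ≠ 0) {P Q : Matrix (Fin m) (Fin m) ℝ}
    (hP : IsGainMatrix θ P) (hQ : IsGainMatrix θ Q) : P = Q := by
  have eP := gain_equation_iff.1 hP.2
  have eQ := gain_equation_iff.1 hQ.2
  suffices H : ∀ s : ℕ, ∀ i j : Fin m, (i : ℕ) + j = s → P i j = Q i j from
    Matrix.ext fun i j => H _ i j rfl
  intro s
  induction s using Nat.strong_induction_on with
  | _ s ih =>
    intro i j hij
    have h := (eP i j).trans (eQ i j).symm
    have h1 : (if (i : ℕ) = 0 then 0 else P ⟨i - 1, by omega⟩ j) =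
        if (i : ℕ) = 0 then 0 else Q ⟨i - 1, by omega⟩ j := by
      split_ifs with h0
      · rfl
      · exact ih (s - 1) (by omega) _ _ (by simp only; omega)
    have h2 : (if (j : ℕ) = 0 then 0 else P i ⟨j - 1, by omega⟩) =
        if (j : ℕ) = 0 then 0 else Q i ⟨j - 1, by omega⟩ := by
      split_ifs with h0
      · rfl
      · exact ih (s - 1) (by omega) _ _ (by simp only; omega)
    rw [h1, h2] at h
    exact mul_left_cancel₀ hθ (by linarith)

/-- The signed upper triangular Pascal matrix. -/
def pascal (m : ℕ) : Matrix (Fin m) (Fin m) ℝ :=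
  of fun k i => (-1) ^ (i : ℕ) * ((i : ℕ).choose k : ℝ)

/-- The diagonal scaling by `θ⁻¹ ^ j`. -/
noncomputable def scaling (m : ℕ) (θ : ℝ) : Matrix (Fin m) (Fin m) ℝ :=
  diagonal fun i => θ⁻¹ ^ (i : ℕ)

/-- The solution of the gain equation. -/
noncomputable def gainMatrix (m : ℕ) (θ : ℝ) : Matrix (Fin m) (Fin m) ℝ :=
  θ⁻¹ • ((pascal m * scaling m θ)ᵀ * (pascal m * scaling m θ))

theorem det_pascal_ne_zero : (pascal m).det ≠ 0 := by
  rw [det_of_isUpperTriangular]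
  · simp [pascal, Finset.prod_ne_zero_iff]
  · intro i j hij
    have : (j : ℕ) < i := hij
    simp [pascal, Nat.choose_eq_zero_of_lt this]

theorem det_scaling_ne_zero {θ : ℝ} (hθ : θ ≠ 0) : (scaling m θ).det ≠ 0 := by
  simp [scaling, Finset.prod_ne_zero_iff, hθ]

/-- Vandermonde's identity; terms with `k > a` vanish, so the range may stop at `m`. -/
theorem sum_choose_mul_choose (a b : ℕ) (ha : a < m) :
    ∑ k : Fin m, a.choose k * b.choose k = (a + b).choose a := by
  rw [Fin.sum_univ_eq_sum_range fun k => a.choose k * b.choose k, Nat.add_choose_eq,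
    Finset.Nat.sum_antidiagonal_eq_sum_range_succ fun x y => a.choose x * b.choose y]
  conv_rhs => rw [← Finset.sum_range_reflect]
  rw [← Finset.sum_subset (Finset.range_subset_range.2 (show a.succ ≤ m by omega))]
  · refine Finset.sum_congr rfl fun k hk => ?_
    rw [Finset.mem_range] at hk
    rw [show a.succ - 1 - k = a - k by omega, Nat.choose_symm (show k ≤ a by omega),
      show a - (a - k) = k by omega]
  · intro k _ hk
    rw [Finset.mem_range] at hk
    rw [Nat.choose_eq_zero_of_lt (by omega), zero_mul]

theorem gainMatrix_apply (θ : ℝ) (i j : Fin m) :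
    gainMatrix m θ i j =
      (-1) ^ (i + j : ℕ) * ((i + j : ℕ).choose i : ℝ) * θ⁻¹ ^ (i + j + 1 : ℕ) := by
  rw [← sum_choose_mul_choose (i : ℕ) (j : ℕ) i.isLt]
  rw [gainMatrix, Matrix.smul_apply, mul_apply, smul_eq_mul]
  simp only [transpose_apply, scaling, mul_diagonal, pascal, of_apply]
  push_cast
  rw [Finset.mul_sum, Finset.mul_sum, Finset.sum_mul]
  refine Finset.sum_congr rfl fun k _ => ?_
  ring

/-- The factorization through an invertible matrix gives definiteness, and on the closed form of the
entries the gain equation is Pascal's rule. -/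
theorem isGainMatrix_gainMatrix {θ : ℝ} (hθ : 0 < θ) : IsGainMatrix θ (gainMatrix m θ) := by
  have hθ' := hθ.ne'
  constructor
  · refine PosDef.smul ?_ (inv_pos.2 hθ)
    rw [← conjTranspose_eq_transpose_of_trivial]
    refine PosDef.conjTranspose_mul_self _ (mulVec_injective_of_isUnit ?_)
    rw [isUnit_iff_isUnit_det, det_mul]
    exact (mul_ne_zero det_pascal_ne_zero (det_scaling_ne_zero hθ')).isUnit
  · refine gain_equation_iff.2 fun i j => ?_
    simp only [gainMatrix_apply, rowC]
    obtain ⟨i, hi⟩ := i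
    obtain ⟨j, hj⟩ := j
    simp only
    rcases i with _ | i <;> rcases j with _ | j
    · simp [hθ']
    · simp
      field_simp
      ring
    · simp
      field_simp
      ring
    · have e1 : (i + 1 + (j + 1)).choose (i + 1) = (i + (j + 1)).choose i
          + (i + 1 + j).choose (i + 1) := by
        rw [show i + 1 + (j + 1) = (i + j + 1) + 1 by ring, Nat.choose_succ_succ',
          show i + (j + 1) = i + j + 1 by ring, show i + 1 + j = i + j + 1 by ring]
      simp [e1]
      field_simp
      ring

theorem existsUnique_isGainMatrix {θ : ℝ} (hθ : 0 < θ) :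
    ∃! P : Matrix (Fin m) (Fin m) ℝ, IsGainMatrix θ P :=
  ⟨gainMatrix m θ, isGainMatrix_gainMatrix hθ, fun _ h =>
    h.unique hθ.ne' (isGainMatrix_gainMatrix hθ)⟩

end Gain


/-! ### Absolute continuity of solutions and a Grönwall inequality. -/

section AbsolutelyContinuous

open Filter MeasureTheory

theorem absolutelyContinuousOnInterval_of_dist_le {X Y : Type*} [PseudoMetricSpace X]
    [PseudoMetricSpace Y] {f : ℝ → X} {g : ℝ → Y} {a b K : ℝ}
    (hg : AbsolutelyContinuousOnInterval g a b)
    (h : ∀ x ∈ Set.uIcc a b, ∀ y ∈ Set.uIcc a b, dist (f x) (f y) ≤ K * dist (g x) (g y)) :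
    AbsolutelyContinuousOnInterval f a b := by
  have hK := Tendsto.const_mul K hg
  rw [mul_zero] at hK
  refine squeeze_zero' (.of_forall fun E => Finset.sum_nonneg fun _ _ => dist_nonneg) ?_ hK
  filter_upwards [mem_inf_of_right (mem_principal_self _)] with E hE
  rw [Finset.mul_sum]
  exact Finset.sum_le_sum fun i hi => h _ (hE.1 i hi).1 _ (hE.1 i hi).2

theorem absolutelyContinuousOnInterval_sum {ι : Type*} {f : ι → ℝ → ℝ} {a b : ℝ} (I : Finset ι)
    (hf : ∀ i ∈ I, AbsolutelyContinuousOnInterval (f i) a b) :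
    AbsolutelyContinuousOnInterval (fun t => ∑ i ∈ I, f i t) a b := by
  classical
  induction I using Finset.induction_on with
  | empty =>
    simp only [Finset.sum_empty]
    exact (contDiffOn_const (c := (0 : ℝ))).absolutelyContinuousOnInterval
  | insert i I hi ih =>
    simp only [Finset.sum_insert hi]
    exact (hf i (Finset.mem_insert_self _ _)).fun_add
      (ih fun j hj => hf j (Finset.mem_insert_of_mem hj))

variable {E : Type*} [NormedAddCommGroup E] [NormedSpace ℝ E] {F : ℝ → E → E} {w : ℝ → E}
  {s T : ℝ}

/-- The increments of `w` are dominated by those of the scalar integral of the norm of the field. -/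
theorem IsSolutionOn.absolutelyContinuousOnInterval (h : IsSolutionOn F w s T) (hsT : s ≤ T) :
    AbsolutelyContinuousOnInterval w s T := by
  refine absolutelyContinuousOnInterval_of_dist_le (K := 1)
    (h.1.norm.absolutelyContinuousOnInterval_intervalIntegral Set.left_mem_uIcc)
    fun a ha b hb => ?_
  rw [Set.uIcc_of_le hsT] at ha hb
  have hs : s ∈ Set.Icc s T := Set.left_mem_Icc.2 hsT
  rw [one_mul, dist_comm, dist_eq_norm, h.sub_eq_integral ha hb, dist_comm, Real.dist_eq,
    intervalIntegral.integral_interval_sub_left (h.intervalIntegrable_of_mem hs hb).norm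
      (h.intervalIntegrable_of_mem hs ha).norm]
  exact intervalIntegral.norm_integral_le_abs_integral_norm

theorem IsSolutionOn.ae_hasDerivAt [CompleteSpace E] (h : IsSolutionOn F w s T) (hsT : s ≤ T) :
    ∀ᵐ t, t ∈ Set.Icc s T → HasDerivAt w (F t (w t)) t := by
  have h₁ : ∀ᵐ t : ℝ, t ≠ s := by simp [ae_iff, measure_singleton]
  have h₂ : ∀ᵐ t : ℝ, t ≠ T := by simp [ae_iff, measure_singleton]
  filter_upwards [h.1.ae_hasDerivAt_integral, h₁, h₂] with t ht hts htT htm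
  rw [Set.uIcc_of_le hsT] at ht
  refine ((ht htm s (Set.left_mem_Icc.2 hsT)).const_add (w s)).congr_of_eventuallyEq ?_
  filter_upwards [Icc_mem_nhds (htm.1.lt_of_ne' hts) (htm.2.lt_of_ne htT)] with τ hτ
  exact h.2 τ hτ

/-- A linear differential inequality for an absolutely continuous function. -/
theorem le_exp_mul_add_of_ae_deriv_le {V V' : ℝ → ℝ} {c b : ℝ} (hc : 0 < c) (hb : 0 ≤ b)
    (hsT : s ≤ T) (hV : AbsolutelyContinuousOnInterval V s T)
    (hderiv : ∀ᵐ t, t ∈ Set.Icc s T → HasDerivAt V (V' t) t ∧ V' t ≤ -(c * V t) + b) :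
    V T ≤ Real.exp (-(c * (T - s))) * V s + b / c := by
  -- Integrating factor: `W` has nonpositive derivative almost everywhere, and absolute continuity
  -- lets this be integrated.
  set W : ℝ → ℝ := fun t => Real.exp (c * t) * (V t - b / c) with hW
  have hexp : AbsolutelyContinuousOnInterval (fun t => Real.exp (c * t)) s T :=
    ContDiffOn.absolutelyContinuousOnInterval (by fun_prop)
  have hcst : AbsolutelyContinuousOnInterval (fun _ : ℝ => b / c) s T :=
    ContDiffOn.absolutelyContinuousOnInterval contDiffOn_const
  have hWac : AbsolutelyContinuousOnInterval W s T := hexp.fun_mul (hV.fun_sub hcst)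
  have hle : W T - W s ≤ 0 := by
    rw [← hWac.integral_deriv_eq_sub, intervalIntegral.integral_of_le hsT]
    refine integral_nonpos_of_ae ?_
    rw [EventuallyLE, ae_restrict_iff' measurableSet_Ioc]
    filter_upwards [hderiv] with t ht htm
    obtain ⟨h1, h2⟩ := ht (Set.Ioc_subset_Icc_self htm)
    have hd : HasDerivAt W (Real.exp (c * t) * (c * 1) * (V t - b / c) +
        Real.exp (c * t) * V' t) t :=
      (((hasDerivAt_id t).const_mul c).exp).mul (h1.sub_const _)
    rw [hd.deriv]
    have : Real.exp (c * t) * (c * 1) * (V t - b / c) + Real.exp (c * t) * V' t =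
        Real.exp (c * t) * (c * V t - b + V' t) := by field_simp
    rw [this]
    exact mul_nonpos_of_nonneg_of_nonpos (Real.exp_pos _).le (by linarith)
  have hT : V T - b / c ≤ Real.exp (-(c * (T - s))) * (V s - b / c) := by
    have e : Real.exp (-(c * (T - s))) = Real.exp (c * s) / Real.exp (c * T) := by
      rw [← Real.exp_sub]; ring_nf
    rw [e, div_mul_eq_mul_div, le_div_iff₀ (Real.exp_pos _), mul_comm]
    simp only [hW] at hle
    linarith
  have : 0 ≤ Real.exp (-(c * (T - s))) * (b / c) := by positivity
  linarith

end AbsolutelyContinuous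

/-! ### Lyapunov inequality for the observer error. -/

section ErrorDynamics

open Matrix

variable {m : ℕ}

theorem rowC_dotProduct (hm : 0 < m) (z : Fin m → ℝ) : rowC m ⬝ᵥ z = z ⟨0, hm⟩ := by
  rw [dotProduct, Finset.sum_eq_single ⟨0, hm⟩]
  · simp [rowC]
  · intro j _ hj
    simp [rowC, show (j : ℕ) ≠ 0 from fun h => hj (Fin.ext h)]
  · simp

/-- The part of the triangular field that is not the shift. -/
def triangularRest (α : (Fin m → ℝ) → ℝ) (β : (j : Fin m) → (Fin (j + 1) → ℝ) → ℝ)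
    (z : Fin m → ℝ) (c : ℝ) : Fin m → ℝ :=
  fun j => (if (j : ℕ) + 1 < m then 0 else α z) + β j (fun k => z (Fin.castLE j.isLt k)) * c

theorem triangularField_eq (α : (Fin m → ℝ) → ℝ) (β : (j : Fin m) → (Fin (j + 1) → ℝ) → ℝ)
    (z : Fin m → ℝ) (c : ℝ) :
    triangularField α β z c = shiftA m *ᵥ z + triangularRest α β z c := by
  ext j
  have : (shiftA m *ᵥ z) j = if hj : (j : ℕ) + 1 < m then z ⟨j + 1, hj⟩ else 0 := by
    simp only [mulVec, dotProduct, shiftA, of_apply, ite_mul, one_mul, zero_mul]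
    split_ifs with hj
    · rw [Finset.sum_eq_single ⟨j + 1, hj⟩]
      · simp
      · exact fun k _ hk => if_neg fun h => hk (Fin.ext h.symm)
      · simp
    · exact Finset.sum_eq_zero fun k _ => if_neg (by omega)
  rw [Pi.add_apply, this, triangularField, triangularRest]
  split_ifs <;> ring

theorem IsGainMatrix.symm_apply {θ : ℝ} {P : Matrix (Fin m) (Fin m) ℝ} (hP : IsGainMatrix θ P)
    (a b : Fin m → ℝ) : a ⬝ᵥ P *ᵥ b = b ⬝ᵥ P *ᵥ a := by
  have hsymm : Pᵀ = P := by
    rw [← conjTranspose_eq_transpose_of_trivial]; exact hP.1.1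
  rw [dotProduct_mulVec, ← mulVec_transpose, hsymm, dotProduct_comm]

/-- The derivative of the quadratic Lyapunov function along the error dynamics. -/
theorem IsGainMatrix.lyapunov_le {θ : ℝ} {P : Matrix (Fin m) (Fin m) ℝ} (hP : IsGainMatrix θ P)
    (e d : Fin m → ℝ) (ν : ℝ) :
    2 * ((shiftA m *ᵥ e + d - (rowC m ⬝ᵥ e - ν) • (P⁻¹ *ᵥ rowC m)) ⬝ᵥ P *ᵥ e) ≤
      -(θ * (e ⬝ᵥ P *ᵥ e)) + ν ^ 2 + 2 * (d ⬝ᵥ P *ᵥ e) := by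
  have hunit : IsUnit P.det := hP.1.det_pos.ne'.isUnit
  have h1 : (P⁻¹ *ᵥ rowC m) ⬝ᵥ P *ᵥ e = rowC m ⬝ᵥ e := by
    rw [hP.symm_apply, mulVec_mulVec, mul_nonsing_inv _ hunit, one_mulVec, dotProduct_comm]
  have h2 : 2 * ((shiftA m *ᵥ e) ⬝ᵥ P *ᵥ e) =
      -(θ * (e ⬝ᵥ P *ᵥ e)) + (rowC m ⬝ᵥ e) ^ 2 := by
    have h3 : e ⬝ᵥ ((shiftA m)ᵀ * P) *ᵥ e = (shiftA m *ᵥ e) ⬝ᵥ P *ᵥ e := by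
      rw [← mulVec_mulVec, dotProduct_mulVec, vecMul_transpose]
    have h4 : e ⬝ᵥ (P * shiftA m) *ᵥ e = (shiftA m *ᵥ e) ⬝ᵥ P *ᵥ e := by
      rw [← mulVec_mulVec, hP.symm_apply]
    have h5 : e ⬝ᵥ vecMulVec (rowC m) (rowC m) *ᵥ e = (rowC m ⬝ᵥ e) ^ 2 := by
      rw [vecMulVec_mulVec, dotProduct_comm]
      simp [sq]
    have h6 := congrArg (fun Q => e ⬝ᵥ Q *ᵥ e) hP.2
    simp only [zero_mulVec, dotProduct_zero, add_mulVec, sub_mulVec, neg_mulVec, dotProduct_add,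
      dotProduct_sub, dotProduct_neg, smul_mulVec, dotProduct_smul, smul_eq_mul, h3, h4, h5] at h6
    linarith
  rw [sub_dotProduct, add_dotProduct, smul_dotProduct, h1, smul_eq_mul]
  -- Completing the square with `y = C e`: `y ^ 2 - 2 * (y - ν) * y = ν ^ 2 - (y - ν) ^ 2`.
  nlinarith [sq_nonneg (rowC m ⬝ᵥ e - ν)]

end ErrorDynamics


/-! ### Estimates in the scaled coordinates. -/

section Bounds

open Matrix

variable {m : ℕ}

theorem abs_dotProduct_le (a b : Fin m → ℝ) : |a ⬝ᵥ b| ≤ m * (‖a‖ * ‖b‖) := by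
  refine (Finset.abs_sum_le_sum_abs _ _).trans ?_
  refine (Finset.sum_le_card_nsmul _ _ (‖a‖ * ‖b‖) fun i _ => ?_).trans (by simp)
  rw [abs_mul]
  exact mul_le_mul (norm_le_pi_norm a i) (norm_le_pi_norm b i) (abs_nonneg _) (norm_nonneg _)

theorem sq_norm_le_dotProduct_self (a : Fin m → ℝ) : ‖a‖ ^ 2 ≤ a ⬝ᵥ a := by
  have h0 : 0 ≤ a ⬝ᵥ a := Finset.sum_nonneg fun i _ => mul_self_nonneg _
  rw [← Real.le_sqrt (norm_nonneg a) h0]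
  refine (pi_norm_le_iff_of_nonneg (Real.sqrt_nonneg _)).2 fun i => Real.abs_le_sqrt ?_
  rw [sq]
  exact Finset.single_le_sum (f := fun i => a i * a i) (fun i _ => mul_self_nonneg _)
    (Finset.mem_univ i)

/-- In the scaled coordinates the quadratic form of the gain matrix is `θ⁻¹` times a fixed one. -/
theorem exists_gainMatrix_bounds (m : ℕ) : ∃ l > 0, ∃ k > 0, ∀ θ : ℝ, 0 < θ →
    ∀ a b : Fin m → ℝ,
      l * ‖scaling m θ *ᵥ a‖ ^ 2 ≤ θ * (a ⬝ᵥ gainMatrix m θ *ᵥ a) ∧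
      θ * (a ⬝ᵥ gainMatrix m θ *ᵥ b) ≤ k * (‖scaling m θ *ᵥ a‖ * ‖scaling m θ *ᵥ b‖) := by
  set B : (Fin m → ℝ) →L[ℝ] (Fin m → ℝ) := LinearMap.toContinuousLinearMap (pascal m).mulVecLin
    with hB
  have hBapp : ∀ a, B a = pascal m *ᵥ a := fun a => rfl
  obtain ⟨K, hK, hanti⟩ := ((pascal m).mulVecLin).exists_antilipschitzWith
    (LinearMap.ker_eq_bot.2 (mulVec_injective_of_det_ne_zero det_pascal_ne_zero))
  have hK' : (0 : ℝ) < K := hK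
  have hlow : ∀ a, (K : ℝ)⁻¹ * ‖a‖ ≤ ‖B a‖ := fun a => by
    rw [inv_mul_le_iff₀ hK']
    simpa [hBapp] using hanti.le_mul_dist a 0
  have hform : ∀ θ : ℝ, 0 < θ → ∀ a b : Fin m → ℝ, θ * (a ⬝ᵥ gainMatrix m θ *ᵥ b) =
      B (scaling m θ *ᵥ a) ⬝ᵥ B (scaling m θ *ᵥ b) := fun θ hθ a b => by
    rw [gainMatrix, smul_mulVec, dotProduct_smul, smul_eq_mul, mul_inv_cancel_left₀ hθ.ne',
      ← mulVec_mulVec, dotProduct_mulVec, vecMul_transpose, hBapp, hBapp, mulVec_mulVec,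
      mulVec_mulVec]
  refine ⟨(K : ℝ)⁻¹ ^ 2, by positivity, m * ‖B‖ ^ 2 + 1, by positivity, fun θ hθ a b => ⟨?_, ?_⟩⟩
  · rw [hform θ hθ, ← mul_pow]
    exact (pow_le_pow_left₀ (by positivity) (hlow _) 2).trans (sq_norm_le_dotProduct_self _)
  · rw [hform θ hθ]
    have h1 := B.le_opNorm (scaling m θ *ᵥ a)
    have h2 := B.le_opNorm (scaling m θ *ᵥ b)
    calc _ ≤ m * (‖B (scaling m θ *ᵥ a)‖ * ‖B (scaling m θ *ᵥ b)‖) :=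
          (le_abs_self _).trans (abs_dotProduct_le _ _)
      _ ≤ m * ((‖B‖ * ‖scaling m θ *ᵥ a‖) * (‖B‖ * ‖scaling m θ *ᵥ b‖)) := by gcongr
      _ = m * ‖B‖ ^ 2 * (‖scaling m θ *ᵥ a‖ * ‖scaling m θ *ᵥ b‖) := by ring
      _ ≤ _ := by gcongr; linarith

theorem scaling_mulVec_apply (θ : ℝ) (a : Fin m → ℝ) (i : Fin m) :
    (scaling m θ *ᵥ a) i = θ⁻¹ ^ (i : ℕ) * a i := by
  rw [scaling, mulVec_diagonal]

theorem norm_scaling_mulVec_le {θ : ℝ} (hθ : 1 ≤ θ) (a : Fin m → ℝ) :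
    ‖scaling m θ *ᵥ a‖ ≤ ‖a‖ := by
  have h0 : 0 < θ := by linarith
  refine (pi_norm_le_iff_of_nonneg (norm_nonneg _)).2 fun i => ?_
  rw [scaling_mulVec_apply, norm_mul, norm_pow, Real.norm_of_nonneg (by positivity)]
  exact (mul_le_of_le_one_left (norm_nonneg _)
    (pow_le_one₀ (by positivity) (inv_le_one_of_one_le₀ hθ))).trans (norm_le_pi_norm a i)

theorem abs_apply_le_scaling {θ : ℝ} (hθ : 1 ≤ θ) (a : Fin m → ℝ) {i : Fin m} {k : ℕ}
    (hik : (i : ℕ) ≤ k) : |a i| ≤ θ ^ k * ‖scaling m θ *ᵥ a‖ := by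
  have h0 : 0 < θ := by linarith
  have h := norm_le_pi_norm (scaling m θ *ᵥ a) i
  rw [scaling_mulVec_apply, norm_mul, norm_pow, Real.norm_of_nonneg (by positivity), inv_pow,
    inv_mul_le_iff₀ (by positivity)] at h
  exact h.trans (by gcongr)

theorem norm_le_scaling {θ : ℝ} (hθ : 1 ≤ θ) (a : Fin m → ℝ) :
    ‖a‖ ≤ θ ^ m * ‖scaling m θ *ᵥ a‖ := by
  have h0 : 0 < θ := by linarith
  exact (pi_norm_le_iff_of_nonneg (by positivity)).2 fun i => abs_apply_le_scaling hθ a i.isLt.le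

/-- By the triangular structure, the nonlinearity is Lipschitz in the scaled coordinates with a
constant that does not depend on the scaling. -/
theorem exists_triangularRest_lipschitz {α : (Fin m → ℝ) → ℝ}
    {β : (j : Fin m) → (Fin (j + 1) → ℝ) → ℝ} (hα : ∃ K, LipschitzWith K α)
    (hβ : ∀ j, ∃ K, LipschitzWith K (β j)) (U : ℝ) :
    ∃ L : ℝ, 0 ≤ L ∧ ∀ θ : ℝ, 1 ≤ θ → ∀ (w z : Fin m → ℝ) (c : ℝ), |c| ≤ U →
      ‖scaling m θ *ᵥ (triangularRest α β w c - triangularRest α β z c)‖ ≤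
        L * ‖scaling m θ *ᵥ (w - z)‖ := by
  obtain ⟨Kα, hα⟩ := hα
  choose Kβ hβ using hβ
  refine ⟨Kα + (∑ j, (Kβ j : ℝ)) * |U|, by positivity, fun θ hθ w z c hc => ?_⟩
  have h0 : 0 < θ := by linarith
  refine (pi_norm_le_iff_of_nonneg (by positivity)).2 fun j => ?_
  rw [scaling_mulVec_apply, norm_mul, norm_pow, Real.norm_of_nonneg (by positivity), inv_pow,
    inv_mul_le_iff₀ (by positivity), Pi.sub_apply, Real.norm_eq_abs]
  set N := ‖scaling m θ *ᵥ (w - z)‖ with hN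
  have hNn : 0 ≤ N := norm_nonneg _
  -- Row `j` carries the weight `θ⁻¹ ^ j` and involves only coordinates `i ≤ j`, each at most `θ ^ j
  -- * N`, so the powers cancel. The full-state term `α` is allowed because it occurs only in the
  -- last row.
  have h1 : |(if (j : ℕ) + 1 < m then 0 else α w) - (if (j : ℕ) + 1 < m then 0 else α z)| ≤
      Kα * (θ ^ (j : ℕ) * N) := by
    split_ifs with hj
    · rw [sub_self, abs_zero]; positivity
    · refine (hα.dist_le_mul w z).trans ?_
      gcongr
      rw [dist_eq_norm]
      exact (pi_norm_le_iff_of_nonneg (by positivity)).2 fun i =>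
        abs_apply_le_scaling hθ (w - z) (by omega)
  have h2 : |β j (fun k => w (Fin.castLE j.isLt k)) - β j (fun k => z (Fin.castLE j.isLt k))| ≤
      Kβ j * (θ ^ (j : ℕ) * N) := by
    refine ((hβ j).dist_le_mul _ _).trans ?_
    gcongr
    rw [dist_eq_norm]
    exact (pi_norm_le_iff_of_nonneg (by positivity)).2 fun i =>
      abs_apply_le_scaling hθ (w - z) (by simp only [Fin.val_castLE]; omega)
  have h3 : (Kβ j : ℝ) ≤ ∑ j, (Kβ j : ℝ) :=
    Finset.single_le_sum (f := fun j => (Kβ j : ℝ)) (fun _ _ => NNReal.coe_nonneg _)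
      (Finset.mem_univ j)
  have h4 : triangularRest α β w c j - triangularRest α β z c j =
      ((if (j : ℕ) + 1 < m then 0 else α w) - (if (j : ℕ) + 1 < m then 0 else α z)) +
      (β j (fun k => w (Fin.castLE j.isLt k)) - β j (fun k => z (Fin.castLE j.isLt k))) * c := by
    simp only [triangularRest]; ring
  rw [h4]
  refine (abs_add_le _ _).trans ?_
  rw [abs_mul]
  calc _ ≤ Kα * (θ ^ (j : ℕ) * N) + ((∑ j, (Kβ j : ℝ)) * (θ ^ (j : ℕ) * N)) * |U| := by
        exact add_le_add h1 (mul_le_mul (h2.trans (by gcongr)) (hc.trans (le_abs_self U))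
          (abs_nonneg _) (by positivity))
    _ = _ := by ring

end Bounds

/-! ### Regularity of the quadratic Lyapunov function. -/

section Quadratic

open Matrix

variable {m : ℕ} {e : ℝ → Fin m → ℝ}

theorem absolutelyContinuousOnInterval_quadratic {a b : ℝ} (P : Matrix (Fin m) (Fin m) ℝ)
    (he : AbsolutelyContinuousOnInterval e a b) :
    AbsolutelyContinuousOnInterval (fun t => e t ⬝ᵥ P *ᵥ e t) a b := by
  have hi : ∀ i, AbsolutelyContinuousOnInterval (fun t => e t i) a b := fun i =>
    absolutelyContinuousOnInterval_of_dist_le (K := 1) he fun x _ y _ => by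
      rw [one_mul]; exact dist_le_pi_dist _ _ i
  have hPi : ∀ i, AbsolutelyContinuousOnInterval (fun t => (P *ᵥ e t) i) a b := fun i =>
    absolutelyContinuousOnInterval_sum (f := fun j t => P i j * e t j) Finset.univ
      fun j _ => (hi j).const_mul (P i j)
  exact absolutelyContinuousOnInterval_sum (f := fun i t => e t i * (P *ᵥ e t) i) Finset.univ
    fun i _ => (hi i).fun_mul (hPi i)

theorem hasDerivAt_quadratic {P : Matrix (Fin m) (Fin m) ℝ} {θ t : ℝ} (hP : IsGainMatrix θ P)
    {e' : Fin m → ℝ} (he : HasDerivAt e e' t) :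
    HasDerivAt (fun t => e t ⬝ᵥ P *ᵥ e t) (2 * (e' ⬝ᵥ P *ᵥ e t)) t := by
  have hi := hasDerivAt_pi.1 he
  have hPi : ∀ i, HasDerivAt (fun t => (P *ᵥ e t) i) ((P *ᵥ e') i) t := fun i =>
    HasDerivAt.fun_sum (A := fun j t => P i j * e t j) (u := Finset.univ)
      fun j _ => (hi j).const_mul (P i j)
  have h : HasDerivAt (fun t => e t ⬝ᵥ P *ᵥ e t)
      (∑ i, (e' i * (P *ᵥ e t) i + e t i * (P *ᵥ e') i)) t :=
    HasDerivAt.fun_sum (A := fun i t => e t i * (P *ᵥ e t) i) (u := Finset.univ)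
      fun i _ => (hi i).mul (hPi i)
  convert h using 1
  rw [Finset.sum_add_distrib, two_mul]
  exact congrArg₂ _ rfl (hP.symm_apply _ _)

end Quadratic

/-! ### Exponential decay and the observer constants. -/

namespace ObservableDecomposition

open Matrix

variable {n p : ℕ} {S : SensorSystem n p} (D : ObservableDecomposition S)

/-- The quadratic Lyapunov function decays exponentially up to the noise along the observer error. -/
theorem lyapunov_decay (i : Fin p) {L l k U θ : ℝ} (hl : 0 < l) (hk : 0 < k)
    (hLip : ∀ (w z : Fin (D.N i) → ℝ) (c : ℝ), |c| ≤ U →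
      ‖scaling (D.N i) θ *ᵥ (triangularRest (D.α i) (D.β i) w c
        - triangularRest (D.α i) (D.β i) z c)‖ ≤ L * ‖scaling (D.N i) θ *ᵥ (w - z)‖)
    (hgain : ∀ a b : Fin (D.N i) → ℝ,
      l * ‖scaling (D.N i) θ *ᵥ a‖ ^ 2 ≤ θ * (a ⬝ᵥ gainMatrix (D.N i) θ *ᵥ a) ∧
      θ * (a ⬝ᵥ gainMatrix (D.N i) θ *ᵥ b) ≤
        k * (‖scaling (D.N i) θ *ᵥ a‖ * ‖scaling (D.N i) θ *ᵥ b‖))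
    (hU : ∀ c ∈ S.inputSet, |c| ≤ U) (hθ : 0 < θ) (hθL : 4 * k * L / l ≤ θ)
    {u : ℝ → ℝ} {x : ℝ → Fin n → ℝ} {v : ℝ → ℝ} (hx : S.IsPlantTrajectory u x)
    (hv : ∀ t, 0 ≤ t → |v t| ≤ S.Mv i) {s T : ℝ} {w : ℝ → Fin (D.N i) → ℝ} (hs : 0 ≤ s)
    (hsT : s ≤ T)
    (hw : IsSolutionOn (observerField (D.α i) (D.β i) (gainMatrix (D.N i) θ) u
      (fun t => S.h i (x t) + v t)) w s T) :
    let V := fun t => (w t - S.Phi D.N i (x t)) ⬝ᵥ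
      gainMatrix (D.N i) θ *ᵥ (w t - S.Phi D.N i (x t))
    V T ≤ Real.exp (-(θ / 2 * (T - s))) * V s + S.Mv i ^ 2 / (θ / 2) := by
  intro V
  have hP : IsGainMatrix θ (gainMatrix (D.N i) θ) := isGainMatrix_gainMatrix hθ
  have hxs : IsSolutionOn (fun t w => S.f w + u t • S.g w) x s T :=
    (hx.solution T (hs.trans hsT)).mono ⟨hs, hsT⟩ ⟨hs.trans hsT, le_rfl⟩
  have hφd : Differentiable ℝ fun w => (D.Ξ i w).1 :=
    (D.contDiff_fst_Ξ i).differentiable (by simp)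
  set e : ℝ → Fin (D.N i) → ℝ := fun t => w t - (D.Ξ i (x t)).1 with he
  have hVe : ∀ t, 0 ≤ t → V t = e t ⬝ᵥ gainMatrix (D.N i) θ *ᵥ e t := fun t ht => by
    simp only [V, he, D.Phi_eq i (hx.state_mem t ht)]
  have hac : AbsolutelyContinuousOnInterval e s T := by
    obtain ⟨K, hK⟩ := (D.contDiff_fst_Ξ i).contDiffOn.exists_lipschitzOnWith (by simp)
      S.convex_stateSet S.isCompact_stateSet
    refine (hw.absolutelyContinuousOnInterval hsT).fun_sub
      (absolutelyContinuousOnInterval_of_dist_le (K := K)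
        (hxs.absolutelyContinuousOnInterval hsT) fun a ha b hb => ?_)
    rw [Set.uIcc_of_le hsT] at ha hb
    exact hK.dist_le_mul _ (hx.state_mem a (hs.trans ha.1)) _ (hx.state_mem b (hs.trans hb.1))
  rw [hVe T (hs.trans hsT), hVe s hs]
  refine le_exp_mul_add_of_ae_deriv_le
    (V' := fun t => 2 * ((shiftA (D.N i) *ᵥ e t + (triangularRest (D.α i) (D.β i) (w t) (u t)
        - triangularRest (D.α i) (D.β i) (D.Ξ i (x t)).1 (u t))
        - (rowC (D.N i) ⬝ᵥ e t - v t) • ((gainMatrix (D.N i) θ)⁻¹ *ᵥ rowC (D.N i)))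
      ⬝ᵥ gainMatrix (D.N i) θ *ᵥ e t))
    (half_pos hθ) (sq_nonneg _) hsT (absolutelyContinuousOnInterval_quadratic _ hac) ?_
  filter_upwards [hw.ae_hasDerivAt hsT, hxs.ae_hasDerivAt hsT] with t hwt hxt ht
  have ht0 : 0 ≤ t := hs.trans ht.1
  have hxm := hx.state_mem t ht0
  have hzt : HasDerivAt (fun t => (D.Ξ i (x t)).1)
      (triangularField (D.α i) (D.β i) (D.Ξ i (x t)).1 (u t)) t := by
    rw [← D.transformed i _ hxm]
    exact (hφd (x t)).hasFDerivAt.comp_hasDerivAt t (hxt ht)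
  refine ⟨hasDerivAt_quadratic hP ?_, ?_⟩
  · convert! (hwt ht).sub hzt using 1
    -- The output is the first coordinate, so the correction term depends only on `C e` and the
    -- noise.
    have hout : S.h i (x t) = rowC (D.N i) ⬝ᵥ (D.Ξ i (x t)).1 := by
      rw [rowC_dotProduct (D.N_pos i), D.output i _ hxm]
    simp only [observerField, triangularField_eq, he, hout, mulVec_sub, dotProduct_sub,
      sub_sub]
    abel
  · refine (hP.lyapunov_le _ _ _).trans ?_
    have h1 : v t ^ 2 ≤ S.Mv i ^ 2 := sq_le_sq' (abs_le.1 (hv t ht0)).1 (abs_le.1 (hv t ht0)).2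
    have h2 := (hgain (triangularRest (D.α i) (D.β i) (w t) (u t)
        - triangularRest (D.α i) (D.β i) (D.Ξ i (x t)).1 (u t)) (e t)).2
    have h3 := hLip (w t) (D.Ξ i (x t)).1 (u t) (hU _ (hx.input_mem t ht0))
    have h4 := (hgain (e t) (e t)).1
    rw [div_le_iff₀ hl] at hθL
    set d := triangularRest (D.α i) (D.β i) (w t) (u t)
        - triangularRest (D.α i) (D.β i) (D.Ξ i (x t)).1 (u t)
    set Q := e t ⬝ᵥ gainMatrix (D.N i) θ *ᵥ e t
    set r := ‖scaling (D.N i) θ *ᵥ e t‖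
    have hr : 0 ≤ r := norm_nonneg _
    have h5 : θ * (d ⬝ᵥ gainMatrix (D.N i) θ *ᵥ e t) ≤ k * L * r ^ 2 := by
      refine h2.trans ?_
      have := mul_le_mul_of_nonneg_right h3 hr
      have := mul_le_mul_of_nonneg_left this hk.le
      linarith
    -- Twice this uses up half of the decay `-θ Q`; the condition `4 * k * L / l ≤ θ` is chosen for
    -- it.
    have h6 : d ⬝ᵥ gainMatrix (D.N i) θ *ᵥ e t ≤ θ / 4 * Q := by
      have h7 : k * L * r ^ 2 ≤ θ / 4 * (l * r ^ 2) := by nlinarith [sq_nonneg r]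
      have h8 : θ * (d ⬝ᵥ gainMatrix (D.N i) θ *ᵥ e t) ≤ θ * (θ / 4 * Q) := by
        nlinarith
      exact le_of_mul_le_mul_left h8 hθ
    linarith

/-- For all sufficiently large gains, constants of a partial observer exist, with monotone
dependence on the gain. -/
theorem exists_observer_constants (i : Fin p) :
    ∃ θs : ℝ, 1 ≤ θs ∧ ∃ η ε : ℝ → ℝ,
      MonotoneOn η (Set.Ici θs) ∧ MonotoneOn ε (Set.Ici θs) ∧
      ∀ θ : ℝ, θs ≤ θ →
        (∃! P : Matrix (Fin (D.N i)) (Fin (D.N i)) ℝ, IsGainMatrix θ P) ∧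
        ∀ P : Matrix (Fin (D.N i)) (Fin (D.N i)) ℝ, IsGainMatrix θ P →
          D.ObserverEstimate i P θ (η θ) (ε θ) := by
  obtain ⟨U, hU⟩ : ∃ U : ℝ, ∀ c ∈ S.inputSet, |c| ≤ U :=
    S.isCompact_inputSet.isBounded.exists_norm_le
  obtain ⟨L, -, hLip⟩ := exists_triangularRest_lipschitz (D.lipschitz_α i) (D.lipschitz_β i) U
  obtain ⟨l, hl, k, hk, hgain⟩ := exists_gainMatrix_bounds (D.N i)
  have hmono : ∀ C : ℝ, 0 ≤ C →
      MonotoneOn (fun θ : ℝ => θ ^ D.N i * C) (Set.Ici (max 1 (4 * k * L / l))) :=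
    fun C hC a ha b _ hab => by
      have : 0 ≤ a := zero_le_one.trans ((le_max_left _ _).trans ha)
      dsimp only
      gcongr
  -- The factor `θ ^ D.N i` undoes the scaling. Under the roots, `k / l` and `2 * Mv ^ 2 / l` are
  -- doubled, so that the squared error is at most the mean of the two squares and hence at most the
  -- larger one.
  refine ⟨max 1 (4 * k * L / l), le_max_left _ _, fun θ => θ ^ D.N i * √(2 * k / l),
    fun θ => θ ^ D.N i * √(4 * S.Mv i ^ 2 / l), hmono _ (Real.sqrt_nonneg _),
    hmono _ (Real.sqrt_nonneg _), fun θ hθs => ?_⟩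
  have hθ1 : 1 ≤ θ := (le_max_left _ _).trans hθs
  have hθ : 0 < θ := by linarith
  refine ⟨existsUnique_isGainMatrix hθ, fun P hP => ?_⟩
  obtain rfl : P = gainMatrix (D.N i) θ := hP.unique hθ.ne' (isGainMatrix_gainMatrix hθ)
  intro u x v hx hv s T w hs hsT hw t ht
  have hdecay := D.lyapunov_decay i hl hk (hLip θ hθ1) (hgain θ hθ) hU hθ
    ((le_max_right _ _).trans hθs) hx hv hs ht.1 (hw.mono ⟨le_rfl, hsT⟩ ht)
  simp only at hdecay
  set e₀ := w s - S.Phi D.N i (x s)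
  set e := w t - S.Phi D.N i (x t)
  have h1 := (hgain θ hθ e e).1
  have h2 := (hgain θ hθ e₀ e₀).2
  have h3 := norm_le_scaling hθ1 e
  have h4 := norm_scaling_mulVec_le hθ1 e₀
  set E := Real.exp (-(θ / 8) * (t - s)) with hE
  -- `V` decays at rate `θ / 2`, and rate `θ / 4` would already suffice, since the norm is of the
  -- order of the square root of `V`.
  have hexp : Real.exp (-(θ / 2 * (t - s))) ≤ E ^ 2 := by
    rw [hE, ← Real.exp_nat_mul]
    refine Real.exp_le_exp.2 ?_
    have := mul_nonneg hθ.le (sub_nonneg.2 ht.1)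
    push_cast
    linarith
  have h5 : l * ‖scaling (D.N i) θ *ᵥ e‖ ^ 2 ≤ E ^ 2 * (k * ‖e₀‖ ^ 2) + 2 * S.Mv i ^ 2 := by
    have h6 : θ * (e₀ ⬝ᵥ gainMatrix (D.N i) θ *ᵥ e₀) ≤ k * ‖e₀‖ ^ 2 := by
      refine h2.trans ?_
      rw [← sq]
      gcongr
    have h7 := mul_le_mul_of_nonneg_left hdecay hθ.le
    have h8 : θ * (S.Mv i ^ 2 / (θ / 2)) = 2 * S.Mv i ^ 2 := by field_simp
    have h9 : Real.exp (-(θ / 2 * (t - s))) * (θ * (e₀ ⬝ᵥ gainMatrix (D.N i) θ *ᵥ e₀)) ≤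
        E ^ 2 * (k * ‖e₀‖ ^ 2) :=
      (mul_le_mul_of_nonneg_left h6 (Real.exp_pos _).le).trans
        (mul_le_mul_of_nonneg_right hexp (by positivity))
    linarith
  set A := θ ^ D.N i * √(2 * k / l) * E * ‖e₀‖ with hA
  set B := θ ^ D.N i * √(4 * S.Mv i ^ 2 / l) with hB
  have hA0 : 0 ≤ A := by positivity
  have hB0 : 0 ≤ B := by positivity
  have hsq : ‖e‖ ^ 2 ≤ (A ^ 2 + B ^ 2) / 2 := by
    have hA2 : A ^ 2 = (θ ^ D.N i) ^ 2 * (2 * k / l) * E ^ 2 * ‖e₀‖ ^ 2 := by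
      rw [hA, mul_pow, mul_pow, mul_pow, Real.sq_sqrt (by positivity)]
    have hB2 : B ^ 2 = (θ ^ D.N i) ^ 2 * (4 * S.Mv i ^ 2 / l) := by
      rw [hB, mul_pow, Real.sq_sqrt (by positivity)]
    have h10 : ‖scaling (D.N i) θ *ᵥ e‖ ^ 2 ≤
        (E ^ 2 * (k * ‖e₀‖ ^ 2) + 2 * S.Mv i ^ 2) / l := by
      rw [le_div_iff₀ hl, mul_comm]; exact h5
    calc ‖e‖ ^ 2 ≤ (θ ^ D.N i * ‖scaling (D.N i) θ *ᵥ e‖) ^ 2 := by gcongr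
      _ ≤ (θ ^ D.N i) ^ 2 * ((E ^ 2 * (k * ‖e₀‖ ^ 2) + 2 * S.Mv i ^ 2) / l) := by
        rw [mul_pow]; gcongr
      _ = (A ^ 2 + B ^ 2) / 2 := by
        rw [hA2, hB2]; field_simp; ring
  rcases le_total A B with hAB | hAB
  · rw [max_eq_right hAB]
    exact abs_le_of_sq_le_sq' (by nlinarith) hB0 |>.2
  · rw [max_eq_left hAB]
    exact abs_le_of_sq_le_sq' (by nlinarith) hA0 |>.2

end ObservableDecomposition

end ResilientEstimation

theorem theorem2 {n p q : ℕ} (S : SensorSystem n p) (D : ObservableDecomposition S)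
    (hobs : S.RedundantObservable D.N (2 * q)) :
    -- constants of the partial observers exist for all sufficiently large gains
    (∀ i : Fin p, ∃ θs : ℝ, 1 ≤ θs ∧ ∃ η ε : ℝ → ℝ,
      MonotoneOn η (Set.Ici θs) ∧ MonotoneOn ε (Set.Ici θs) ∧
      ∀ θ : ℝ, θs ≤ θ →
        (∃! P : Matrix (Fin (D.N i)) (Fin (D.N i)) ℝ, IsGainMatrix θ P) ∧
        ∀ P : Matrix (Fin (D.N i)) (Fin (D.N i)) ℝ, IsGainMatrix θ P →
          D.ObserverEstimate i P θ (η θ) (ε θ)) ∧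
    -- and for all such constants the switching scheme works
    (∀ (θ η ε Mz : Fin p → ℝ) (P : (i : Fin p) → Matrix (Fin (D.N i)) (Fin (D.N i)) ℝ)
      (_ : ∀ i, 0 < θ i) (_ : ∀ i, IsGainMatrix (θ i) (P i))
      (_ : ∀ i, D.ObserverEstimate i (P i) (θ i) (η i) (ε i))
      (_ : ∀ i, ∀ x ∈ S.stateSet, ‖S.Phi D.N i x‖ ≤ Mz i)
      -- Lipschitz-extended left inverses and the enumeration of the index sets
      (Ψ : (I : Finset (Fin p)) → ((i : I) → Fin (D.N i) → ℝ) → (Fin n → ℝ))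
      (_ : ∀ I : Finset (Fin p), I.card = p - q →
        IsLipschitzLeftInverse S.stateSet (S.PhiSub D.N I) (Ψ I))
      (Λ : ℕ → Finset (Fin p))
      (_ : Set.BijOn Λ (Set.Icc 1 (p.choose (p - q))) {I | I.card = p - q})
      -- the plant, the noise and the attack
      (u : ℝ → ℝ) (x : ℝ → Fin n → ℝ) (v a : Fin p → ℝ → ℝ)
      (_ : S.IsPlantTrajectory u x) (_ : ∀ i t, 0 ≤ t → |v i t| ≤ S.Mv i)
      (Δ₁ Δ₂ Δ : ℝ) (_ : 0 ≤ Δ₁) (_ : 0 ≤ Δ₂) (_ : Δ₁ + Δ₂ < Δ)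
      (_ : ∀ i, (max (2 * η i * Mz i) (ε i) + 2 * Mz i) * η i * Real.exp (-(θ i / 8) * Δ₁) ≤ ε i)
      (_ : ∀ i, 2 * Mz i * η i * Real.exp (-(θ i / 8) * Δ₂) ≤ ε i)
      (_ : ∀ t : ℝ, 0 ≤ t → p - q ≤ (attackFree a Δ t).ncard)
      -- the partial observers with the reset rule
      (zhat zplus : (i : Fin p) → ℝ → Fin (D.N i) → ℝ) (resets : Fin p → Set ℝ)
      (_ : ∀ i, IsResetTrajectory
        (observerField (D.α i) (D.β i) (P i) u (fun t => S.h i (x t) + a i t + v i t))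
        (Mz i) (max (2 * η i * Mz i) (ε i) + Mz i) (zhat i) (zplus i) (resets i))
      -- the threshold, the residual test and the switching signal
      (δ : ℝ → ℝ) (_ : δ = threshold Mz θ η ε)
      (alarm : ℕ → ℝ → Prop) (_ : alarm = residualAlarm D Λ Ψ δ zhat)
      (τ : ℕ → EReal) (_ : τ = switchTime (p.choose (p - q)) alarm)
      (σ : ℝ → ℕ) (_ : σ = switchSignal (p.choose (p - q)) alarm)
      (xhat : ℝ → Fin n → ℝ) (_ : xhat = fun t => Ψ (Λ (σ t)) (fun i => zhat i t)),
      -- only finitely many updates in every bounded time interval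
      (∀ T : ℝ, {j : ℕ | τ j ≤ (T : EReal)}.Finite) ∧
      -- the error bound at all times that are not switching times
      ∀ t : ℝ, 0 ≤ t → (∀ j : ℕ, τ (j + 1) ≠ (t : EReal)) →
        ‖xhat t - x t‖ ≤
          ((⨆ I : {I : Finset (Fin p) // I.card = p - q}, D.residualLip I.1 (Ψ I.1)) + 1)
            / (⨅ J : {J : Finset (Fin p) // J.card = p - 2 * q},
                lipLower (S.PhiSub D.N J.1) S.stateSet)
            * δ t) := by
  refine ⟨D.exists_observer_constants, ?_⟩
  intro θ η ε Mz P hθ _ hest hMz Ψ hΨ Λ hΛ u x v a hx hv Δ₁ Δ₂ Δ hΔ₁ hΔ₂ hΔ h₁ h₂ hatt zhat zplus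
    resets hz δ hδ alarm halarm τ hτ σ hσ xhat hxhat
  obtain ⟨hnonneg, hgood⟩ :=
    exists_accurate_observers S D hθ hest hMz hx hv hΔ₁ hΔ₂ hΔ h₁ h₂ hatt hz
  subst hδ halarm hτ hσ hxhat
  exact switched_estimate S D hobs hnonneg hx.state_mem hΨ hΛ hgood
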